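/- Let $C$ be a commutative ring with identity and let $X$ be a set. A *Baxter $C$-algebra of weight $-1$ not necessarily having an identity* is a pair $(R,P)$ where $R$ is a commutative associative $C$-algebra, possibly without identity, and $P:R\to R$ is a $C$-linear map with $P(x)P(y)=P(xP(y))+P(yP(x))-P(xy)$ for all $x,y\in R$. These form a category $\mathrm{Bax}^0_C$, whose morphisms are the $C$-linear multiplicative maps that commute with the operators. Let $\mathrm{Bax}_C$ be the category of those $(R,P)$ for which $R$ has an identity, with the morphisms of $\mathrm{Bax}^0_C$ that preserve the identity. **The Baxter algebra $Ш_C(X)$.** For $m,n\ge 0$ a *mixable $(m,n)$-shuffle* is a pair $(\sigma,T)$, where $\sigma$ is a permutation of $\{1,\dots,m+n\}$ with $\sigma^{-1}(1)<\dots<\sigma^{-1}(m)$ and $\sigma^{-1}(m+1)<\dots<\sigma^{-1}(m+n)$, and $T$ is a set of pairs $(k,k+1)$ with $1\le k<m+n$ and $\sigma(k)\le m<\sigma(k+1)$. Let $A=C[X]$ be the polynomial algebra and $$Ш_C(X)=\bigoplus_{k\ge 0}A^{\otimes(k+1)}=A\otimes_C\bigoplus_{k\ge0}A^{\otimes k},$$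 with the $C$-bilinear product $$(x_0\otimes x_1\otimes\dots\otimes x_m)\diamond(y_0\otimes y_1\otimes\dots\otimes y_n)=x_0y_0\otimes\sum_{(\sigma,T)}(-1)^{|T|}\,u_{\sigma(1)}\hat\otimes u_{\sigma(2)}\hat\otimes\cdots\hat\otimes u_{\sigma(m+n)},$$ where $(\sigma,T)$ runs over the mixable $(m,n)$-shuffles, $(u_1,\dots,u_{m+n})=(x_1,\dots,x_m,y_1,\dots,y_n)$, and $\hat\otimes$ between the positions $k$ and $k+1$ is the multiplication of $A$ if $(k,k+1)\in T$ and is $\otimes$ otherwise. The identity is $1\in A$, and the operator is $P_X(x_0\otimes\dots\otimes x_n)=1\otimes x_0\otimes\dots\otimes x_n$. **Cartier's Baxter algebra $\mathfrak B(X)$.** Let $M$ be the free commutative monoid on $X$. Let $\mathfrak B(X)$ be the free $C$-module on the symbols $u_0\cdot[u_1,\dots,u_m]$ with $m\ge 0$, $u_i\in M$ and $u_m\neq 1$, with the $C$-bilinear product given by $$(u_0\cdot[\ ])\diamond_c(v_0\cdot[v_1,\dots,v_n])=(v_0\cdot[v_1,\dots,v_n])\diamond_c(u_0\cdot[\ ])=u_0v_0\cdot[v_1,\dots,v_n]\qquad(n\ge0)$$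 and, for $m,n\ge 1$, $$(u_0\cdot[u_1,\dots,u_m])\diamond_c(v_0\cdot[v_1,\dots,v_n])=\sum_{(k,P,Q)}(-1)^{k+m+n}\,u_0v_0\cdot[c_1,\dots,c_k].$$ Here $1\le k\le m+n$, and $P,Q\subseteq\{1,\dots,k\}$ satisfy $P\cup Q=\{1,\dots,k\}$, $|P|=m$ and $|Q|=n$. The letter $c_j$ is $u_\alpha$ if $j$ is the $\alpha$-th element of $P$ and $j\notin Q$, it is $v_\beta$ if $j$ is the $\beta$-th element of $Q$ and $j\notin P$, and it is $u_\alpha v_\beta$ if $j$ is both. The operator is $P^c_X(u_0\cdot[u_1,\dots,u_m])=1\cdot[u_0,u_1,\dots,u_m]$. Let $f:\mathfrak B(X)\to Ш_C(X)$ be the $C$-linear map with $f(u_0\cdot[u_1,\dots,u_m])=u_0\otimes u_1\otimes\dots\otimes u_m$. **Proposition.** $(\mathfrak B(X),P^c_X)$ is an object of $\mathrm{Bax}^0_C$, $(Ш_C(X),P_X)$ is an object of $\mathrm{Bax}_C$, and $f$ is an injective morphism in $\mathrm{Bax}^0_C$ with the following universal property. For any object $(A,P)$ of $\mathrm{Bax}_C$,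 also regarded as an object of $\mathrm{Bax}^0_C$, and any morphism $\phi:\mathfrak B(X)\to A$ in $\mathrm{Bax}^0_C$, there is a unique morphism $\tilde\phi:Ш_C(X)\to A$ in $\mathrm{Bax}_C$ such that $\tilde\phi\circ f=\phi$. -/

import Mathlib

open scoped TensorProduct DirectSum

noncomputable section

namespace MixableShuffle

universe u v w

/-! ### Baxter algebras -/

section Baxter

variable {C : Type u} [CommRing C] {R : Type v} [AddCommGroup R] [Module C R] [Mul R]
  {S : Type w} [AddCommGroup S] [Module C S] [Mul S]

/-- `P` is a Baxter operator of weight `lam` on `R` over `C`. The `C`-linearity is in the type. -/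
def IsBaxterOperator (lam : C) (P : R →ₗ[C] R) : Prop :=
  ∀ x y : R, P x * P y = P (x * P y) + P (y * P x) + lam • P (x * y)

/-- `(R, P)` is a (commutative) Baxter `C`-algebra of weight `lam`, not necessarily having an
identity. -/
structure IsNonUnitalBaxterAlgebra (lam : C) (P : R →ₗ[C] R) : Prop where
  mul_assoc : ∀ x y z : R, x * y * z = x * (y * z)
  mul_comm : ∀ x y : R, x * y = y * x
  add_mul : ∀ x y z : R, (x + y) * z = x * z + y * z
  smul_mul : ∀ (c : C) (x y : R), (c • x) * y = c • (x * y)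
  baxter : IsBaxterOperator lam P

/-- `(R, P)` is a (commutative) Baxter `C`-algebra of weight `lam` with identity `1`. -/
structure IsBaxterAlgebra [One R] (lam : C) (P : R →ₗ[C] R) : Prop
    extends IsNonUnitalBaxterAlgebra lam P where
  one_mul : ∀ x : R, 1 * x = x

/-- Morphisms of not necessarily unital Baxter `C`-algebras: `C`-linear maps which preserve the
multiplication and commute with the operators. -/
structure IsNonUnitalBaxterHom (P : R →ₗ[C] R) (Q : S →ₗ[C] S) (g : R →ₗ[C] S) : Prop where
  map_mul : ∀ x y : R, g (x * y) = g x * g y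
  map_op : ∀ x : R, g (P x) = Q (g x)

/-- Morphisms of Baxter `C`-algebras with identity. -/
structure IsBaxterHom [One R] [One S] (P : R →ₗ[C] R) (Q : S →ₗ[C] S) (g : R →ₗ[C] S) : Prop
    extends IsNonUnitalBaxterHom P Q g where
  map_one : g 1 = 1

end Baxter

/-! ### Mixable shuffles

Positions and letters are numbered from `0`. -/

/-- The `(m, n)`-shuffles: permutations `σ` of the `m + n` letters with
`σ⁻¹(0) < ⋯ < σ⁻¹(m - 1)` and `σ⁻¹(m) < ⋯ < σ⁻¹(m + n - 1)`. -/
def shuffles (m n : ℕ) : Finset (Equiv.Perm (Fin (m + n))) :=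
  open scoped Classical in
  Finset.univ.filter fun σ =>
    StrictMono (fun i : Fin m => σ.symm (Fin.castAdd n i)) ∧
    StrictMono (fun j : Fin n => σ.symm (Fin.natAdd m j))

/-- The admissible pairs `(k, k + 1)` of `σ`, given by their left members `k`:
`σ(k)` is one of the first `m` letters and `σ(k + 1)` is one of the last `n` letters. -/
def admissiblePairs {m n : ℕ} (σ : Equiv.Perm (Fin (m + n))) : Finset (Fin (m + n)) :=
  open scoped Classical in
  Finset.univ.filter fun k =>
    ∃ h : k.val + 1 < m + n, (σ k).val < m ∧ m ≤ (σ ⟨k.val + 1, h⟩).val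

/-- The mixable `(m, n)`-shuffles: pairs `(σ, T)` with `σ` an `(m, n)`-shuffle and `T` a set of
admissible pairs of `σ`. -/
def mixableShuffles (m n : ℕ) : Finset (Σ _ : Equiv.Perm (Fin (m + n)), Finset (Fin (m + n))) :=
  (shuffles m n).sigma fun σ => (admissiblePairs σ).powerset

/-- Auxiliary function for `merge`: `a` is the current factor and `k` the position of the last
letter in it. -/
def mergeAux {A : Type*} [Mul A] (T : Finset ℕ) : A → ℕ → List A → List A
  | a, _, [] => [a]
  | a, k, b :: l => if k ∈ T then mergeAux T (a * b) (k + 1) l else a :: mergeAux T b (k + 1) l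

/-- The word obtained from `z₀, z₁, z₂, …` by multiplying the letters in the positions `k` and
`k + 1` whenever `k ∈ T`. -/
def merge {A : Type*} [Mul A] (T : Finset ℕ) : List A → List A
  | [] => []
  | a :: l => mergeAux T a 0 l

theorem ofFn_update {A : Type*} {N : ℕ} [DecidableEq (Fin N)] (z : Fin N → A) (i : Fin N) (x : A) :
    List.ofFn (Function.update z i x) = (List.ofFn z).set i x := by
  apply List.ext_getElem
  · simp
  · intro j h₁ h₂
    simp only [List.getElem_ofFn, List.getElem_set, Function.update_apply, Fin.ext_iff]
    by_cases h : j = i.val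
    · simp [h]
    · simp [h, Ne.symm h]

section Tensor

variable (C : Type u) [CommRing C] (A : Type v) [CommRing A] [Algebra C A]

/-- The `C`-module `⨁ₖ A^{⊗ k}` underlying the mixable shuffle algebra. -/
abbrev Tens : Type (max u v) := ⨁ k : ℕ, ⨂[C]^k A

variable {A}

/-- The pure tensor `x₁ ⊗ ⋯ ⊗ xₖ` in `A^{⊗ k}`, for a word `[x₁, …, xₖ]`. -/
def pureTensor (l : List A) : Tens C A :=
  DirectSum.lof C ℕ (fun k => ⨂[C]^k A) l.length (PiTensorProduct.tprod C l.get)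

variable (A)

/-- The bilinear map `(a, x) ↦ a ⊗ x`, `A × A^{⊗ k} → A^{⊗ (k + 1)}`; here `*` is the
concatenation product of tensors. -/
def prepend : A →ₗ[C] Tens C A →ₗ[C] Tens C A :=
  LinearMap.mk₂ C (fun a x =>
      DirectSum.lof C ℕ (fun k => ⨂[C]^k A) 1 (PiTensorProduct.tprod C fun _ : Fin 1 => a) * x)
    (fun a b x => by
      have h := (PiTensorProduct.tprod C (s := fun _ : Fin 1 => A)).map_update_add
        (fun _ => (0 : A)) 0 a b
      have e : ∀ c : A, Function.update (fun _ : Fin 1 => (0 : A)) 0 c = fun _ => c := by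
        intro c; funext i; rw [Subsingleton.elim i 0]; simp
      simp only [e] at h
      rw [h, map_add, add_mul])
    (fun c a x => by
      have h := (PiTensorProduct.tprod C (s := fun _ : Fin 1 => A)).map_update_smul
        (fun _ => (0 : A)) 0 c a
      have e : ∀ c : A, Function.update (fun _ : Fin 1 => (0 : A)) 0 c = fun _ => c := by
        intro c; funext i; rw [Subsingleton.elim i 0]; simp
      simp only [e] at h
      rw [h, map_smul, smul_mul_assoc])
    (fun a x y => mul_add _ _ _)
    (fun c a x => mul_smul_comm _ _ _)

variable {A}

theorem prepend_pureTensor (a : A) (l : List A) :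
    prepend C A a (pureTensor C l) = pureTensor C (a :: l) := by
  simp only [prepend, LinearMap.mk₂_apply, pureTensor, DirectSum.lof_eq_of, DirectSum.of_mul_of]
  apply DirectSum.of_eq_of_gradedMonoid_eq
  rw [TensorPower.tprod_mul_tprod]
  refine TensorPower.gradedMonoid_eq_of_cast (Nat.add_comm _ _) ?_
  change TensorPower.cast C A _ (PiTensorProduct.tprod C _) = PiTensorProduct.tprod C _
  refine (TensorPower.cast_tprod C A (Nat.add_comm 1 l.length) _).trans ?_
  congr 1
  funext i
  refine Fin.cases ?_ (fun j => ?_) i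
  · simp [Fin.append, Fin.addCases]
  · simp [Fin.append, Fin.addCases]

theorem pureTensor_mergeAux_add_left (T : Finset ℕ) (a b : A) (k : ℕ) (l : List A) :
    pureTensor C (mergeAux T (a + b) k l) =
      pureTensor C (mergeAux T a k l) + pureTensor C (mergeAux T b k l) := by
  induction l generalizing a b k with
  | nil => simp only [mergeAux, ← prepend_pureTensor, map_add, LinearMap.add_apply]
  | cons c l ih =>
    by_cases h : k ∈ T
    · simp only [mergeAux, h, if_true, add_mul, ih]
    · simp only [mergeAux, h, if_false, ← prepend_pureTensor, map_add, LinearMap.add_apply]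

theorem pureTensor_mergeAux_smul_left (T : Finset ℕ) (c : C) (a : A) (k : ℕ) (l : List A) :
    pureTensor C (mergeAux T (c • a) k l) = c • pureTensor C (mergeAux T a k l) := by
  induction l generalizing a k with
  | nil => simp only [mergeAux, ← prepend_pureTensor, map_smul, LinearMap.smul_apply]
  | cons d l ih =>
    by_cases h : k ∈ T
    · simp only [mergeAux, h, if_true, smul_mul_assoc, ih]
    · simp only [mergeAux, h, if_false, ← prepend_pureTensor, map_smul, LinearMap.smul_apply]

theorem pureTensor_mergeAux_set_add (T : Finset ℕ) (a : A) (k : ℕ) (l : List A) (i : ℕ)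
    (hi : i < l.length) (x y : A) :
    pureTensor C (mergeAux T a k (l.set i (x + y))) =
      pureTensor C (mergeAux T a k (l.set i x)) + pureTensor C (mergeAux T a k (l.set i y)) := by
  induction l generalizing a k i with
  | nil => simp at hi
  | cons c l ih =>
    cases i with
    | zero =>
      by_cases h : k ∈ T
      · simp only [List.set_cons_zero, mergeAux, h, if_true, mul_add, pureTensor_mergeAux_add_left]
      · simp only [List.set_cons_zero, mergeAux, h, if_false, ← prepend_pureTensor,
          pureTensor_mergeAux_add_left, map_add]
    | succ i =>
      have hi' : i < l.length := by simpa using hi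
      by_cases h : k ∈ T
      · simp only [List.set_cons_succ, mergeAux, h, if_true, ih _ _ _ hi']
      · simp only [List.set_cons_succ, mergeAux, h, if_false, ← prepend_pureTensor,
          ih _ _ _ hi', map_add]

theorem pureTensor_mergeAux_set_smul (T : Finset ℕ) (a : A) (k : ℕ) (l : List A) (i : ℕ)
    (hi : i < l.length) (c : C) (x : A) :
    pureTensor C (mergeAux T a k (l.set i (c • x))) =
      c • pureTensor C (mergeAux T a k (l.set i x)) := by
  induction l generalizing a k i with
  | nil => simp at hi
  | cons d l ih =>
    cases i with
    | zero =>
      by_cases h : k ∈ T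
      · simp only [List.set_cons_zero, mergeAux, h, if_true, mul_smul_comm,
          pureTensor_mergeAux_smul_left]
      · simp only [List.set_cons_zero, mergeAux, h, if_false, ← prepend_pureTensor,
          pureTensor_mergeAux_smul_left, map_smul]
    | succ i =>
      have hi' : i < l.length := by simpa using hi
      by_cases h : k ∈ T
      · simp only [List.set_cons_succ, mergeAux, h, if_true, ih _ _ _ hi']
      · simp only [List.set_cons_succ, mergeAux, h, if_false, ← prepend_pureTensor,
          ih _ _ _ hi', map_smul]

theorem pureTensor_merge_set_add (T : Finset ℕ) (l : List A) (i : ℕ) (hi : i < l.length)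
    (x y : A) :
    pureTensor C (merge T (l.set i (x + y))) =
      pureTensor C (merge T (l.set i x)) + pureTensor C (merge T (l.set i y)) := by
  cases l with
  | nil => simp at hi
  | cons a l =>
    cases i with
    | zero => exact pureTensor_mergeAux_add_left C T x y 0 l
    | succ i => exact pureTensor_mergeAux_set_add C T a 0 l i (by simpa using hi) x y

theorem pureTensor_merge_set_smul (T : Finset ℕ) (l : List A) (i : ℕ) (hi : i < l.length)
    (c : C) (x : A) :
    pureTensor C (merge T (l.set i (c • x))) = c • pureTensor C (merge T (l.set i x)) := by
  cases l with
  | nil => simp at hi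
  | cons a l =>
    cases i with
    | zero => exact pureTensor_mergeAux_smul_left C T c x 0 l
    | succ i => exact pureTensor_mergeAux_set_smul C T a 0 l i (by simpa using hi) c x

/-- `z₁ ⊗̂ z₂ ⊗̂ ⋯ ⊗̂ z_N` as a multilinear map: the tensor product of the `zᵢ`, with `⊗` between
the positions `k` and `k + 1` replaced by the multiplication of `A` for the `k ∈ T`. -/
def mergeTensor (T : Finset ℕ) (N : ℕ) : MultilinearMap C (fun _ : Fin N => A) (Tens C A) where
  toFun z := pureTensor C (merge T (List.ofFn z))
  map_update_add' z i x y := by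
    simp only [ofFn_update]
    exact pureTensor_merge_set_add C T _ _ (by simp) x y
  map_update_smul' z i c x := by
    simp only [ofFn_update]
    exact pureTensor_merge_set_smul C T _ _ (by simp) c x

variable (A) {C}

/-- The mixable shuffle product of weight `lam` on `A^{⊗ m} × A^{⊗ n}`: on pure tensors,
`x ⋄ y = ∑_{(σ, T)} lam ^ |T| u_{σ(1)} ⊗̂ ⋯ ⊗̂ u_{σ(m + n)}`, where `u` is the concatenation of
`x` and `y`. For `m = 0` or `n = 0` the only summand is the one of the identity, so that this is
scalar multiplication. -/
def mixableShuffleProductAux (lam : C) (m n : ℕ) : ⨂[C]^m A →ₗ[C] ⨂[C]^n A →ₗ[C] Tens C A :=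
  TensorProduct.curry
    ((∑ p ∈ mixableShuffles m n, lam ^ p.2.card •
        PiTensorProduct.lift
          ((mergeTensor C (A := A) (p.2.map Fin.valEmbedding) (m + n)).domDomCongr p.1)) ∘ₗ
      (TensorPower.mulEquiv (R := C) (M := A) (n := m) (m := n)).toLinearMap)

/-- The mixable shuffle product of weight `lam` on `⨁ₖ A^{⊗ k}`. -/
def mixableShuffleProduct (lam : C) : Tens C A →ₗ[C] Tens C A →ₗ[C] Tens C A :=
  DirectSum.toModule C ℕ _ fun m =>
    LinearMap.flip (DirectSum.toModule C ℕ _ fun n => (mixableShuffleProductAux A lam m n).flip)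

variable {A}

theorem mixableShuffleProductAux_tprod (lam : C) {m n : ℕ} (x : Fin m → A) (y : Fin n → A) :
    mixableShuffleProductAux A lam m n (PiTensorProduct.tprod C x) (PiTensorProduct.tprod C y) =
      ∑ p ∈ mixableShuffles m n, lam ^ p.2.card •
        pureTensor C (merge (p.2.map Fin.valEmbedding)
          (List.ofFn fun i => Fin.append x y (p.1 i))) := by
  have h : TensorPower.mulEquiv (PiTensorProduct.tprod C x ⊗ₜ[C] PiTensorProduct.tprod C y) =
      PiTensorProduct.tprod C (Fin.append x y) := TensorPower.tprod_mul_tprod C x y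
  simp only [mixableShuffleProductAux, TensorProduct.curry_apply, LinearMap.comp_apply,
    LinearEquiv.coe_coe, h, LinearMap.sum_apply, LinearMap.smul_apply,
    PiTensorProduct.lift.tprod, MultilinearMap.domDomCongr_apply]
  rfl

theorem mixableShuffleProduct_pureTensor (lam : C) (x y : List A) :
    mixableShuffleProduct A lam (pureTensor C x) (pureTensor C y) =
      ∑ p ∈ mixableShuffles x.length y.length, lam ^ p.2.card •
        pureTensor C (merge (p.2.map Fin.valEmbedding)
          (List.ofFn fun i => Fin.append x.get y.get (p.1 i))) := by
  rw [← mixableShuffleProductAux_tprod]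
  simp only [mixableShuffleProduct, pureTensor, DirectSum.toModule_lof, LinearMap.flip_apply]

/-! ### The Baxter algebra `Ш_C(A)` -/

variable (A)

/-- The `C`-module `Ш_C(A) = A ⊗ ⨁ₖ A^{⊗ k}`; the weight `lam` determines its multiplication. It is
a type of its own, so that it does not inherit the multiplication of a tensor product with the
tensor algebra. -/
def Sha (_lam : C) : Type (max u v) := A ⊗[C] Tens C A

variable (lam : C)

instance : AddCommGroup (Sha A lam) := inferInstanceAs (AddCommGroup (A ⊗[C] Tens C A))

instance : Module C (Sha A lam) := inferInstanceAs (Module C (A ⊗[C] Tens C A))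

/-- The element `a ⊗ x` of `Ш_C(A)`. -/
def Sha.mk (a : A) (x : Tens C A) : Sha A lam := (a ⊗ₜ[C] x : A ⊗[C] Tens C A)

/-- The augmented mixable shuffle product: the multiplication
`(x₀ ⊗ x) ⋄ (y₀ ⊗ y) = x₀ y₀ ⊗ (x ⋄⁺ y)` of the tensor product of `A` and the mixable shuffle
algebra. -/
def Sha.mulMap : Sha A lam →ₗ[C] Sha A lam →ₗ[C] Sha A lam :=
  TensorProduct.map₂ (LinearMap.mul C A) (mixableShuffleProduct A lam)

instance : Mul (Sha A lam) := ⟨fun x y => Sha.mulMap A lam x y⟩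

instance : One (Sha A lam) := ⟨Sha.mk A lam 1 (pureTensor C [])⟩

theorem Sha.mk_mul_mk (a b : A) (x y : Tens C A) :
    Sha.mk A lam a x * Sha.mk A lam b y =
      Sha.mk A lam (a * b) (mixableShuffleProduct A lam x y) :=
  rfl

/-- The operator `P_A (x₀ ⊗ x₁ ⊗ ⋯ ⊗ xₙ) = 1 ⊗ x₀ ⊗ x₁ ⊗ ⋯ ⊗ xₙ` on `Ш_C(A)`. -/
def Sha.op : Sha A lam →ₗ[C] Sha A lam :=
  TensorProduct.mk C A (Tens C A) 1 ∘ₗ TensorProduct.lift (prepend C A)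

theorem Sha.op_mk (a : A) (l : List A) :
    Sha.op A lam (Sha.mk A lam a (pureTensor C l)) = Sha.mk A lam 1 (pureTensor C (a :: l)) := by
  rw [← prepend_pureTensor]
  rfl

end Tensor

/-! ### The Baxter algebra `Ш_C(X)` -/

section Set

variable (C : Type u) [CommRing C] (X : Type v)

/-- `Ш_C(X) = Ш_C(C[X])`, of weight `-1`. -/
abbrev ShaOn : Type (max u v) := Sha (MvPolynomial X C) (-1 : C)

/-- The operator `P_X` on `Ш_C(X)`. -/
abbrev ShaOn.op : ShaOn C X →ₗ[C] ShaOn C X := Sha.op (MvPolynomial X C) (-1 : C)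

/-! ### Cartier's Baxter algebra `𝔅(X)` -/

/-- The free commutative semigroup with identity on `X`, written multiplicatively. -/
abbrev Mon : Type v := Multiplicative (X →₀ ℕ)

/-- The symbols `u₀ · [u₁, …, uₘ]` with `m ≥ 0` whose last entry (`u₀` if `m = 0`) is not `1`,
given as the pair of `u₀` and the word `u₁, …, uₘ`. -/
def Symb : Type v :=
  {w : Mon X × List (Mon X) // (w.1 :: w.2).getLast (List.cons_ne_nil _ _) ≠ 1}

/-- The free `C`-module on the symbols. -/
def Cartier : Type (max u v) := Symb X →₀ C

instance : AddCommGroup (Cartier C X) := inferInstanceAs (AddCommGroup (Symb X →₀ C))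

instance : Module C (Cartier C X) := inferInstanceAs (Module C (Symb X →₀ C))

/-- The basis element of `𝔅(X)` given by a symbol. -/
def Cartier.of {X : Type v} (w : Symb X) : Cartier C X := (Finsupp.single w 1 : Symb X →₀ C)

/-- The linear extension of a map on symbols. -/
def Cartier.lift {X : Type v} {N : Type w} [AddCommGroup N] [Module C N] (g : Symb X → N) :
    Cartier C X →ₗ[C] N :=
  (Finsupp.linearCombination C g : (Symb X →₀ C) →ₗ[C] N)

theorem Cartier.lift_of {X : Type v} {N : Type w} [AddCommGroup N] [Module C N] (g : Symb X → N)
    (w : Symb X) : Cartier.lift C g (Cartier.of C w) = g w :=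
  (Finsupp.linearCombination_single C (1 : C) w).trans (one_smul C (g w))

variable {X}

/-- The triples `(k, P, Q)` with `1 ≤ k ≤ m + n` and `P ∪ Q = {1, …, k}`, `|P| = m`, `|Q| = n`. -/
structure Triple (m n : ℕ) where
  k : Fin (m + n + 1)
  one_le : 1 ≤ k.val
  P : Finset (Fin k)
  Q : Finset (Fin k)
  union : P ∪ Q = Finset.univ
  cardP : P.card = m
  cardQ : Q.card = n

variable {m n : ℕ}

instance : Finite (Triple m n) := by
  refine Finite.of_injective
    (β := Σ k : Fin (m + n + 1), Finset (Fin k) × Finset (Fin k)) (fun t => ⟨t.k, t.P, t.Q⟩) ?_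
  rintro ⟨k, _, P, Q, _, _, _⟩ ⟨k', _, P', Q', _, _, _⟩ h
  simp only [Sigma.mk.injEq] at h
  obtain ⟨rfl, h⟩ := h
  simp only [heq_eq_eq, Prod.mk.injEq] at h
  obtain ⟨rfl, rfl⟩ := h
  rfl

instance : Fintype (Triple m n) := Fintype.ofFinite _

/-- The letter `c_j` of `Φ_{k,P,Q}([a₁, …, aₘ], [b₁, …, bₙ])`: it is `a_α` if `j` is the `α`-th
element of `P` and not in `Q`, it is `b_β` if `j` is the `β`-th element of `Q` and not in `P`, and
it is `a_α b_β` if `j` is both the `α`-th element of `P` and the `β`-th element of `Q`. -/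
def Triple.letter (t : Triple m n) (a : Fin m → Mon X) (b : Fin n → Mon X) (j : Fin t.k) : Mon X :=
  (if h : j ∈ t.P then a ((t.P.orderIsoOfFin t.cardP).symm ⟨j, h⟩) else 1) *
    (if h : j ∈ t.Q then b ((t.Q.orderIsoOfFin t.cardQ).symm ⟨j, h⟩) else 1)

/-- The word `Φ_{k,P,Q}([a₁, …, aₘ], [b₁, …, bₙ]) = [c₁, …, c_k]`. -/
def Triple.word (t : Triple m n) (a : Fin m → Mon X) (b : Fin n → Mon X) : List (Mon X) :=
  List.ofFn (t.letter a b)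

theorem Mon.mul_ne_one {a b : Mon X} (h : a ≠ 1 ∨ b ≠ 1) : a * b ≠ 1 := by
  intro hab
  have h' : Multiplicative.toAdd a + Multiplicative.toAdd b = 0 := hab
  rw [add_eq_zero] at h'
  exact h.elim (fun ha => ha h'.1) (fun hb => hb h'.2)

theorem rank_last {k m : ℕ} (P : Finset (Fin k)) (hP : P.card = m) (j : Fin k)
    (hj : ∀ i, i ≤ j) (h : j ∈ P) (i : Fin m) : i ≤ (P.orderIsoOfFin hP).symm ⟨j, h⟩ := by
  rw [OrderIso.le_symm_apply]
  exact hj _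

theorem getLast_ne_one {l : List (Mon X)} (hl : l ≠ []) (h : l.getLast hl ≠ 1)
    (i : Fin l.length) (hi : ∀ j, j ≤ i) : l.get i ≠ 1 := by
  have hpos : 0 < l.length := List.length_pos_of_ne_nil hl
  have h1 : i.val = l.length - 1 := by
    have h2 : l.length - 1 ≤ i.val := hi ⟨l.length - 1, by omega⟩
    have h3 := i.isLt
    omega
  rw [List.getLast_eq_getElem] at h
  simpa [List.get_eq_getElem, h1] using h

theorem Triple.word_ne_nil (t : Triple m n) (a : Fin m → Mon X) (b : Fin n → Mon X) :
    t.word a b ≠ [] := by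
  have h := t.one_le
  intro h'
  have h'' := congrArg List.length h'
  simp only [Triple.word, List.length_ofFn, List.length_nil] at h''
  omega

theorem Triple.getLast_word_ne_one {a b : List (Mon X)} (t : Triple a.length b.length)
    (ha : a ≠ []) (hb : b ≠ []) (ha' : a.getLast ha ≠ 1) (hb' : b.getLast hb ≠ 1) :
    (t.word a.get b.get).getLast (t.word_ne_nil _ _) ≠ 1 := by
  have hk := t.one_le
  have key : ∀ j : Fin t.k, (∀ i, i ≤ j) → t.letter a.get b.get j ≠ 1 := by
    intro j hj
    have hu : j ∈ t.P ∪ t.Q := t.union ▸ Finset.mem_univ j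
    rw [Finset.mem_union] at hu
    refine Mon.mul_ne_one (hu.imp (fun h => ?_) (fun h => ?_))
    · rw [dif_pos h]
      exact getLast_ne_one ha ha' _ (rank_last t.P t.cardP j hj h)
    · rw [dif_pos h]
      exact getLast_ne_one hb hb' _ (rank_last t.Q t.cardQ j hj h)
  rw [List.getLast_eq_getElem]
  simp only [Triple.word, List.getElem_ofFn, List.length_ofFn]
  refine key _ fun i => ?_
  have := i.isLt
  rw [Fin.le_def]
  simp only
  omega

theorem Symb.getLast_ne_one (w : Symb X) (h : w.1.2 ≠ []) : w.1.2.getLast h ≠ 1 := by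
  have := w.2
  rwa [List.getLast_cons h] at this

theorem getLast_head_mul_ne_one (a : Mon X) {b : Mon X} {l : List (Mon X)}
    (h : (b :: l).getLast (List.cons_ne_nil _ _) ≠ 1) :
    ((a * b) :: l).getLast (List.cons_ne_nil _ _) ≠ 1 := by
  cases l with
  | nil => exact Mon.mul_ne_one (Or.inr h)
  | cons c l => simpa using h

/-- The product of two symbols. -/
def Symb.mul (w v : Symb X) : Cartier C X :=
  if hw : w.1.2 = [] then
    Cartier.of C ⟨(w.1.1 * v.1.1, v.1.2), getLast_head_mul_ne_one _ v.2⟩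
  else if hv : v.1.2 = [] then
    Cartier.of C ⟨(w.1.1 * v.1.1, w.1.2), by
      simpa only [mul_comm w.1.1] using getLast_head_mul_ne_one v.1.1 w.2⟩
  else
    ∑ t : Triple w.1.2.length v.1.2.length,
      ((-1) ^ (t.k.val + t.P.card + t.Q.card) : C) •
        Cartier.of C ⟨(w.1.1 * v.1.1, t.word w.1.2.get v.1.2.get), by
          rw [List.getLast_cons (t.word_ne_nil _ _)]
          exact t.getLast_word_ne_one hw hv (w.getLast_ne_one hw) (v.getLast_ne_one hv)⟩

variable (X)

/-- Cartier's multiplication: the `C`-bilinear extension of the product of symbols. -/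
def Cartier.mulMap : Cartier C X →ₗ[C] Cartier C X →ₗ[C] Cartier C X :=
  Cartier.lift C fun w =>
    Cartier.lift C fun v => Symb.mul C w v

instance : Mul (Cartier C X) := ⟨fun x y => Cartier.mulMap C X x y⟩

theorem Cartier.of_mul_of (w v : Symb X) :
    Cartier.of C w * Cartier.of C v = Symb.mul C w v := by
  change Cartier.mulMap C X (Cartier.of C w) (Cartier.of C v) = _
  rw [Cartier.mulMap, Cartier.lift_of, Cartier.lift_of]

variable {X}

/-- `u₀ · [u₁, …, uₘ] ↦ 1 · [u₀, u₁, …, uₘ]`. -/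
def Symb.op (w : Symb X) : Symb X :=
  ⟨(1, w.1.1 :: w.1.2), by
    rw [List.getLast_cons (List.cons_ne_nil _ _)]
    exact w.2⟩

variable (X)

/-- The operator `P_X^c` on `𝔅(X)`. -/
def Cartier.op : Cartier C X →ₗ[C] Cartier C X :=
  Cartier.lift C fun w => Cartier.of C w.op

variable {X}

/-- A monomial `u ∈ M` as an element of `C[X]`. -/
def mon (u : Mon X) : MvPolynomial X C := MvPolynomial.monomial (Multiplicative.toAdd u) 1

variable (X)

/-- The `C`-linear map `f : 𝔅(X) → Ш_C(X)` with `f (u₀ · [u₁, …, uₘ]) = u₀ ⊗ u₁ ⊗ ⋯ ⊗ uₘ`. -/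
def toSha : Cartier C X →ₗ[C] ShaOn C X :=
  Cartier.lift C fun w =>
    Sha.mk (MvPolynomial X C) (-1 : C) (mon C w.1.1) (pureTensor C (w.1.2.map (mon C)))

end Set

end MixableShuffle
end

open MixableShuffle

/-!
The proof rests on one fact: both products satisfy the quasi-shuffle recursion
`(a ⊗ u) ⋄ (c ⊗ v) = a ⊗ (u ⋄ (c ⊗ v)) + c ⊗ ((a ⊗ u) ⋄ v) + lam (a c ⊗ (u ⋄ v))`,
with `lam = -1` in the case of Cartier's product.

For the mixable shuffle product (`mixableShuffleProduct_eq_quasiShuffle`), a shuffle `σ` is recorded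
by the word of truth values `σ (k) < m`, and its admissible pairs are the places in this word where
`true` is followed by `false`. The word of letters is the interleaving of the two given words along
these truth values, and splitting off the first letter gives the recursion. The third term comes
from the words that begin with `true, false` and whose first two letters are merged.
For Cartier's product (`toSha_symb_mul`), a triple `(k, P, Q)` is recorded by the word of the pairs
of truth values `(j ∈ P, j ∈ Q)`, whose possible first entries give the three terms.

Commutativity and associativity of the mixable shuffle product follow from the recursion by
induction on words, and the Baxter identity for `1 ⊗ a ⊗ u` and `1 ⊗ c ⊗ v` is the recursion itself
(`isBaxterAlgebra_sha`). The map `toSha` is multiplicative since both sides satisfy the same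
recursion, and it is injective since reading off words of monomials is a left inverse up to the
inclusion of the symbols into all words (`toSha_injective`). So `𝔅(X)` inherits its axioms from
`Ш_C(X)`.

For the universal property, an algebra homomorphism `g` from `C[X]` to `A` extends to `Ш_C(X)` by
`a₀ ⊗ a₁ ⊗ ⋯ ⊗ aₖ ↦ g a₀ P (g a₁ P (g a₂ ⋯ P (g aₖ)))`, and this is a morphism by the recursion and
the Baxter identity of `P` (`isBaxterHom_extend`). Given `φ` on `𝔅(X)`, its values on the symbols
`u · [ ]` determine such a `g`. The extension restricts to `φ`, as the symbols `u · [ ]` generate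
`𝔅(X)` (`cartier_hom_ext`), and it is unique, as the identity and the image of `𝔅(X)` generate
`Ш_C(X)` (`shaOn_hom_ext`).
-/

noncomputable section

namespace MixableShuffle

universe u v w

/-! ### Words of letters and merging -/

section Merge

variable {A : Type*} [Mul A]

/-- The set `S + 1` of positions. -/
def shift (S : Finset ℕ) : Finset ℕ := S.map ⟨Nat.succ, Nat.succ_injective⟩

theorem succ_mem_shift {S : Finset ℕ} {k : ℕ} : k + 1 ∈ shift S ↔ k ∈ S := by
  simp [shift]

theorem zero_notMem_shift {S : Finset ℕ} : 0 ∉ shift S := by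
  simp [shift]

theorem card_shift (S : Finset ℕ) : (shift S).card = S.card := by
  simp [shift]

theorem sum_powerset_shift {N : Type*} [AddCommMonoid N] (S : Finset ℕ) (F : Finset ℕ → N) :
    ∑ T ∈ (shift S).powerset, F T = ∑ T ∈ S.powerset, F (shift T) := by
  have h : (shift S).powerset = S.powerset.image shift := by
    have := Finset.powerset_image (s := S) (f := Nat.succ)
    have h' : shift = fun x => x.image Nat.succ := by
      funext x
      simp [shift, Finset.map_eq_image]
    rw [h', this]
  rw [h, Finset.sum_image]
  intro s _ t _ hst
  exact Finset.map_injective _ hst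

/-- `mergeAux` only depends on the set of positions relative to the current one. -/
theorem mergeAux_congr {T T' : Finset ℕ} {k k' : ℕ} (h : ∀ j, k + j ∈ T ↔ k' + j ∈ T') (a : A)
    (l : List A) : mergeAux T a k l = mergeAux T' a k' l := by
  induction l generalizing a k k' with
  | nil => rfl
  | cons b l ih =>
    have h' : ∀ j, (k + 1) + j ∈ T ↔ (k' + 1) + j ∈ T' := fun j => by
      rw [add_assoc, add_assoc]
      exact h _
    have h0 : k ∈ T ↔ k' ∈ T' := h 0
    by_cases hk : k ∈ T
    · simp only [mergeAux, if_pos hk, if_pos (h0.1 hk), ih h']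
    · simp only [mergeAux, if_neg hk, if_neg (fun h => hk (h0.2 h)), ih h']

theorem merge_shift_cons (T : Finset ℕ) (a : A) (z : List A) :
    merge (shift T) (a :: z) = a :: merge T z := by
  cases z with
  | nil => rfl
  | cons b l =>
    simp only [merge, mergeAux, if_neg zero_notMem_shift]
    rw [mergeAux_congr (k' := 0) (T' := T)]
    intro j
    rw [zero_add, zero_add, add_comm, succ_mem_shift]

theorem merge_insert_zero_shift_cons (T : Finset ℕ) (a b : A) (z : List A) :
    merge (insert 0 (shift (shift T))) (a :: b :: z) = (a * b) :: merge T z := by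
  rw [← merge_shift_cons]
  simp only [merge, mergeAux, if_pos (Finset.mem_insert_self _ _)]
  rw [mergeAux_congr]
  intro j
  rw [zero_add, zero_add, add_comm, Finset.mem_insert, succ_mem_shift]
  simp

/-- The word with letters from `x` in the positions where `b` is `true` and letters from `y` in the
positions where `b` is `false`, in order. -/
def interleave {A : Type*} : List Bool → List A → List A → List A
  | [], _, _ => []
  | true :: b, a :: x, y => a :: interleave b x y
  | false :: b, x, c :: y => c :: interleave b x y
  | true :: _, [], _ => []
  | false :: _, _, [] => []

/-- A list is the interleaving of its two sublists given by a predicate, along the values of the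
predicate. -/
theorem interleave_map_filter {L B : Type*} (p : L → Bool) (u : L → B) (l : List L) :
    l.map u = interleave (l.map p) ((l.filter p).map u) ((l.filter (fun i => !p i)).map u) := by
  induction l with
  | nil => rfl
  | cons a l ih => cases h : p a <;> simp [h, interleave, ← ih]

/-- The positions `k` with `b k = true` and `b (k + 1) = false`. -/
def descents (b : List Bool) : Finset ℕ :=
  (Finset.range b.length).filter fun k => b[k]? = some true ∧ b[k + 1]? = some false

theorem mem_descents {b : List Bool} {k : ℕ} :
    k ∈ descents b ↔ b[k]? = some true ∧ b[k + 1]? = some false := by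
  simp only [descents, Finset.mem_filter, Finset.mem_range, and_iff_right_iff_imp]
  rintro ⟨h, -⟩
  exact (List.getElem?_eq_some_iff.1 h).1

theorem descents_nil : descents [] = ∅ := rfl

theorem descents_false_cons (b : List Bool) : descents (false :: b) = shift (descents b) := by
  ext k
  cases k with
  | zero => simp [mem_descents, zero_notMem_shift]
  | succ k => simp [mem_descents, succ_mem_shift]

theorem descents_true : descents [true] = ∅ := by
  ext k
  cases k <;> simp [mem_descents]

theorem descents_true_true_cons (b : List Bool) :
    descents (true :: true :: b) = shift (descents (true :: b)) := by
  ext k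
  cases k with
  | zero => simp [mem_descents, zero_notMem_shift]
  | succ k => simp [mem_descents, succ_mem_shift]

theorem descents_true_false_cons (b : List Bool) :
    descents (true :: false :: b) = insert 0 (shift (shift (descents b))) := by
  rw [← descents_false_cons]
  ext k
  cases k with
  | zero => simp [mem_descents]
  | succ k => simp [mem_descents, succ_mem_shift]

end Merge

/-! ### Sums over words -/

section Words

/-- The words with `m` entries `true` and `n` entries `false`. -/
def boolWords : ℕ → ℕ → Finset (List Bool)
  | 0, 0 => {[]}
  | m + 1, 0 => (boolWords m 0).map ⟨List.cons true, List.cons_injective⟩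
  | 0, n + 1 => (boolWords 0 n).map ⟨List.cons false, List.cons_injective⟩
  | m + 1, n + 1 => (boolWords m (n + 1)).map ⟨List.cons true, List.cons_injective⟩ ∪
      (boolWords (m + 1) n).map ⟨List.cons false, List.cons_injective⟩

theorem mem_boolWords {m n : ℕ} {b : List Bool} :
    b ∈ boolWords m n ↔ b.count true = m ∧ b.count false = n := by
  induction b generalizing m n with
  | nil => cases m <;> cases n <;> simp [boolWords]
  | cons a b ih => cases m <;> cases n <;> cases a <;> simp [boolWords, ih]

variable {N : Type*} [AddCommMonoid N]

theorem sum_boolWords_succ_succ (m n : ℕ) (F : List Bool → N) :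
    ∑ b ∈ boolWords (m + 1) (n + 1), F b =
      ∑ b ∈ boolWords m (n + 1), F (true :: b) + ∑ b ∈ boolWords (m + 1) n, F (false :: b) := by
  rw [boolWords, Finset.sum_union, Finset.sum_map, Finset.sum_map]
  · rfl
  · rw [Finset.disjoint_left]
    simp only [Finset.mem_map, Function.Embedding.coeFn_mk, not_exists, not_and]
    rintro _ ⟨b, -, rfl⟩ c - h
    simp at h

/-- The words in `{true, false}²` in which the first entry is `m` times `true`, the second entry is
`n` times `true`, and `(false, false)` does not occur. -/
def stepWords : ℕ → ℕ → Finset (List (Bool × Bool))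
  | 0, 0 => {[]}
  | m + 1, 0 => (stepWords m 0).map ⟨List.cons (true, false), List.cons_injective⟩
  | 0, n + 1 => (stepWords 0 n).map ⟨List.cons (false, true), List.cons_injective⟩
  | m + 1, n + 1 => (stepWords m (n + 1)).map ⟨List.cons (true, false), List.cons_injective⟩ ∪
      ((stepWords (m + 1) n).map ⟨List.cons (false, true), List.cons_injective⟩ ∪
      (stepWords m n).map ⟨List.cons (true, true), List.cons_injective⟩)

theorem mem_stepWords {m n : ℕ} {s : List (Bool × Bool)} :
    s ∈ stepWords m n ↔
      (s.map Prod.fst).count true = m ∧ (s.map Prod.snd).count true = n ∧ (false, false) ∉ s := by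
  induction s generalizing m n with
  | nil => cases m <;> cases n <;> simp [stepWords]
  | cons a s ih =>
    obtain ⟨a, b⟩ := a
    cases m <;> cases n <;> cases a <;> cases b <;> simp [stepWords, ih]

theorem sum_stepWords_succ_succ (m n : ℕ) (F : List (Bool × Bool) → N) :
    ∑ s ∈ stepWords (m + 1) (n + 1), F s =
      ∑ s ∈ stepWords m (n + 1), F ((true, false) :: s) +
      ∑ s ∈ stepWords (m + 1) n, F ((false, true) :: s) +
      ∑ s ∈ stepWords m n, F ((true, true) :: s) := by
  rw [stepWords, Finset.sum_union, Finset.sum_union, Finset.sum_map, Finset.sum_map,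
    Finset.sum_map, add_assoc]
  · rfl
  · rw [Finset.disjoint_left]
    simp only [Finset.mem_map, Function.Embedding.coeFn_mk, not_exists, not_and]
    rintro _ ⟨b, -, rfl⟩ c - h
    simp at h
  · rw [Finset.disjoint_left]
    simp only [Finset.mem_union, Finset.mem_map, Function.Embedding.coeFn_mk, not_or, not_exists,
      not_and]
    rintro _ ⟨b, -, rfl⟩
    constructor <;> intro c _ h <;> simp at h

end Words

/-! ### The quasi-shuffle recursion -/

section Quasi

variable {C : Type u} [CommRing C] {A : Type v} [CommRing A] [Algebra C A] (lam : C)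

/-- The quasi-shuffle product of two words, defined by its recursion on the first letters. -/
def quasiShuffle : List A → List A → Tens C A
  | [], y => pureTensor C y
  | x, [] => pureTensor C x
  | a :: x, c :: y => prepend C A a (quasiShuffle x (c :: y)) +
      prepend C A c (quasiShuffle (a :: x) y) + lam • prepend C A (a * c) (quasiShuffle x y)
termination_by x y => x.length + y.length

theorem quasiShuffle_nil_left (y : List A) : quasiShuffle lam [] y = pureTensor C y := by
  rw [quasiShuffle]

theorem quasiShuffle_nil_right (x : List A) : quasiShuffle lam x [] = pureTensor C x := by
  cases x <;> simp [quasiShuffle]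

theorem quasiShuffle_cons_cons (a c : A) (x y : List A) :
    quasiShuffle lam (a :: x) (c :: y) = prepend C A a (quasiShuffle lam x (c :: y)) +
      prepend C A c (quasiShuffle lam (a :: x) y) +
      lam • prepend C A (a * c) (quasiShuffle lam x y) := by
  rw [quasiShuffle]

/-- The weighted sum of all words obtained from `z` by merging at a set of positions in `S`. -/
def mergeSum (S : Finset ℕ) (z : List A) : Tens C A :=
  ∑ T ∈ S.powerset, lam ^ T.card • pureTensor C (merge T z)

theorem mergeSum_empty (z : List A) : mergeSum lam ∅ z = pureTensor C (merge ∅ z) := by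
  simp [mergeSum]

theorem mergeSum_shift_cons (S : Finset ℕ) (a : A) (z : List A) :
    mergeSum lam (shift S) (a :: z) = prepend C A a (mergeSum lam S z) := by
  simp only [mergeSum, sum_powerset_shift, map_sum, map_smul, prepend_pureTensor,
    merge_shift_cons, card_shift]

/-- The sets of positions split into those without `0`, which keep `a` as a letter of its own, and
those with `0`, which merge `a` and `c`. The position `1` never occurs, so that `a * c` is not
merged any further. -/
theorem mergeSum_insert_zero_shift_cons (S : Finset ℕ) (a c : A) (z : List A) :
    mergeSum lam (insert 0 (shift (shift S))) (a :: c :: z) =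
      prepend C A a (mergeSum lam (shift S) (c :: z)) +
        lam • prepend C A (a * c) (mergeSum lam S z) := by
  rw [← mergeSum_shift_cons, mergeSum, Finset.sum_powerset_insert zero_notMem_shift, mergeSum]
  congr 1
  rw [sum_powerset_shift, sum_powerset_shift, mergeSum, map_sum, Finset.smul_sum]
  refine Finset.sum_congr rfl fun T _ => ?_
  rw [merge_insert_zero_shift_cons, Finset.card_insert_of_notMem zero_notMem_shift, card_shift,
    card_shift, map_smul, prepend_pureTensor, smul_smul, pow_succ']

/-- The sum over interleavings and merging positions satisfies the quasi-shuffle recursion. -/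
theorem sum_mergeSum_interleave_eq_quasiShuffle (x y : List A) :
    ∑ b ∈ boolWords x.length y.length, mergeSum lam (descents b) (interleave b x y) =
      quasiShuffle lam x y := by
  induction x generalizing y with
  | nil =>
    rw [quasiShuffle_nil_left]
    induction y with
    | nil => simp [boolWords, interleave, descents_nil, mergeSum_empty, merge]
    | cons c y ih =>
      simp only [List.length_nil] at ih
      simp only [List.length_cons, List.length_nil, boolWords, Finset.sum_map,
        Function.Embedding.coeFn_mk, interleave, descents_false_cons, mergeSum_shift_cons,
        ← map_sum, ih, prepend_pureTensor]
  | cons a x ihx =>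
    -- A word beginning with `true` merges its first two letters only if the second letter is
    -- `false`; splitting off that case produces the term of weight `lam`.
    have key : ∀ y : List A, ∑ b ∈ boolWords x.length y.length,
        mergeSum lam (descents (true :: b)) (a :: interleave b x y) =
        prepend C A a (quasiShuffle lam x y) +
        (match y with
          | [] => 0
          | c :: y => lam • prepend C A (a * c) (quasiShuffle lam x y)) := by
      intro y
      have hhead : ∀ b ∈ boolWords x.length 0,
          mergeSum lam (descents (true :: b)) (a :: interleave b x []) =
            prepend C A a (mergeSum lam (descents b) (interleave b x [])) := by
        intro b hb
        rw [mem_boolWords] at hb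
        cases b with
        | nil => simp [descents_true, descents_nil, mergeSum_empty, interleave, prepend_pureTensor,
            merge, mergeAux]
        | cons d b =>
          cases d with
          | true => rw [descents_true_true_cons, mergeSum_shift_cons]
          | false => simp at hb
      cases y with
      | nil =>
        rw [add_zero, ← ihx, map_sum]
        exact Finset.sum_congr rfl hhead
      | cons c y =>
        simp only []
        rw [← ihx, ← ihx, List.length_cons]
        cases hx : x with
        | nil =>
          simp only [List.length_nil, boolWords, Finset.sum_map, Function.Embedding.coeFn_mk,
            interleave, descents_true_false_cons, mergeSum_insert_zero_shift_cons,
            descents_false_cons, Finset.sum_add_distrib, map_sum, Finset.smul_sum]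
        | cons d x =>
          simp only [List.length_cons, sum_boolWords_succ_succ,
            interleave, descents_true_false_cons, mergeSum_insert_zero_shift_cons,
            descents_false_cons, descents_true_true_cons, mergeSum_shift_cons,
            Finset.sum_add_distrib, map_sum, map_add, Finset.smul_sum, add_assoc]
    induction y with
    | nil =>
      have h := key []
      simp only [add_zero, quasiShuffle_nil_right, prepend_pureTensor, List.length_nil] at h
      simp only [quasiShuffle_nil_right, List.length_cons, List.length_nil, boolWords,
        Finset.sum_map, Function.Embedding.coeFn_mk, interleave, h]
    | cons c y ihy =>
      have h := key (c :: y)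
      simp only [List.length_cons] at h ihy
      simp only [List.length_cons, sum_boolWords_succ_succ, interleave, h, descents_false_cons,
        mergeSum_shift_cons, ← map_sum, ihy, quasiShuffle_cons_cons]
      abel

end Quasi

/-! ### Mixable shuffles as words -/

section Shuffles

variable {m n : ℕ}

/-- The word of a shuffle: it records for each position whether its letter is one of the first
`m` letters. -/
def shuffleWord (σ : Equiv.Perm (Fin (m + n))) : List Bool :=
  List.ofFn fun i => decide ((σ i).val < m)

theorem mem_shuffles {σ : Equiv.Perm (Fin (m + n))} :
    σ ∈ shuffles m n ↔ StrictMono (fun i : Fin m => σ.symm (Fin.castAdd n i)) ∧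
      StrictMono (fun j : Fin n => σ.symm (Fin.natAdd m j)) := by
  simp [shuffles]

theorem mem_admissiblePairs {σ : Equiv.Perm (Fin (m + n))} {k : Fin (m + n)} :
    k ∈ admissiblePairs σ ↔
      ∃ h : k.val + 1 < m + n, (σ k).val < m ∧ m ≤ (σ ⟨k.val + 1, h⟩).val := by
  simp [admissiblePairs]

theorem map_admissiblePairs (σ : Equiv.Perm (Fin (m + n))) :
    (admissiblePairs σ).map Fin.valEmbedding = descents (shuffleWord σ) := by
  ext k
  simp only [Finset.mem_map, mem_admissiblePairs, mem_descents, shuffleWord,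
    List.getElem?_eq_some_iff, List.length_ofFn, List.getElem_ofFn, decide_eq_true_eq,
    decide_eq_false_iff_not, not_lt, Fin.valEmbedding_apply]
  constructor
  · rintro ⟨k, ⟨h, h1, h2⟩, rfl⟩
    exact ⟨⟨k.isLt, h1⟩, h, h2⟩
  · rintro ⟨⟨h, h1⟩, h', h2⟩
    exact ⟨⟨k, h⟩, ⟨h', h1, h2⟩, rfl⟩

/-- If `g` enumerates the letters selected by `p`, and their positions under `σ` increase, then
`g` is the sublist of these letters. -/
theorem filter_ofFn_perm {N r : ℕ} (σ : Equiv.Perm (Fin N)) (p : Fin N → Bool) (g : Fin r → Fin N)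
    (hg : StrictMono fun i => σ.symm (g i)) (hp : ∀ j, p j = true ↔ ∃ i, g i = j) :
    (List.ofFn σ).filter p = List.ofFn g := by
  refine List.Perm.eq_of_pairwise (le := fun a b => σ.symm a < σ.symm b) ?_ ?_ ?_ ?_
  · intro a b _ _ h h'
    exact absurd h' (lt_asymm h)
  · refine List.Pairwise.filter _ ?_
    rw [List.pairwise_ofFn]
    intro i j h
    simpa using h
  · rw [List.pairwise_ofFn]
    exact fun i j h => hg h
  · rw [List.perm_ext_iff_of_nodup]
    · intro a
      simp only [List.mem_filter, List.mem_ofFn, hp]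
      exact ⟨fun h => h.2, fun h => ⟨⟨σ.symm a, by simp⟩, h⟩⟩
    · exact (List.nodup_ofFn.2 σ.injective).filter _
    · rw [List.nodup_ofFn]
      intro i j h
      exact hg.injective (congrArg σ.symm h)

theorem filter_ofFn_shuffle_left {σ : Equiv.Perm (Fin (m + n))} (hσ : σ ∈ shuffles m n) :
    (List.ofFn σ).filter (fun i => decide (i.val < m)) = List.ofFn (Fin.castAdd n) := by
  refine filter_ofFn_perm σ _ _ (mem_shuffles.1 hσ).1 fun j => ?_
  refine Fin.addCases (fun i => ?_) (fun i => ?_) j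
  · simp
  · simp only [Fin.ext_iff, Fin.val_castAdd, Fin.val_natAdd, decide_eq_true_eq]
    constructor
    · omega
    · rintro ⟨i, hi⟩
      omega

theorem filter_ofFn_shuffle_right {σ : Equiv.Perm (Fin (m + n))} (hσ : σ ∈ shuffles m n) :
    (List.ofFn σ).filter (fun i => !decide (i.val < m)) = List.ofFn (Fin.natAdd m) := by
  refine filter_ofFn_perm σ _ _ (mem_shuffles.1 hσ).2 fun j => ?_
  refine Fin.addCases (fun i => ?_) (fun i => ?_) j
  · simp only [Fin.ext_iff, Fin.val_castAdd, Fin.val_natAdd, Bool.not_eq_true',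
      decide_eq_false_iff_not]
    constructor
    · omega
    · rintro ⟨i, hi⟩
      omega
  · simp

theorem ofFn_append_shuffle {σ : Equiv.Perm (Fin (m + n))} (hσ : σ ∈ shuffles m n) {B : Type*}
    (x : Fin m → B) (y : Fin n → B) :
    List.ofFn (fun i => Fin.append x y (σ i)) =
      interleave (shuffleWord σ) (List.ofFn x) (List.ofFn y) := by
  have h := interleave_map_filter (fun i : Fin (m + n) => decide (i.val < m)) (Fin.append x y)
    (List.ofFn σ)
  rw [filter_ofFn_shuffle_left hσ, filter_ofFn_shuffle_right hσ] at h
  simpa [List.map_ofFn, Function.comp_def, shuffleWord] using h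

theorem count_ofFn {N : ℕ} (p : Fin N → Bool) (a : Bool) :
    (List.ofFn p).count a = (Finset.univ.filter fun i => p i = a).card := by
  induction N with
  | zero => simp
  | succ N ih =>
    rw [List.ofFn_succ, Fin.card_filter_univ_succ, List.count_cons, ih]
    by_cases h : p 0 = a <;> simp [h]

/-- Taking words is a bijection from the `(m, n)`-shuffles to the words with `m` entries `true` and
`n` entries `false`. -/
theorem sum_shuffles {N : Type*} [AddCommMonoid N] (F : List Bool → N) :
    ∑ σ ∈ shuffles m n, F (shuffleWord σ) = ∑ b ∈ boolWords m n, F b := by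
  refine Finset.sum_nbij shuffleWord ?_ ?_ ?_ fun _ _ => rfl
  · intro σ hσ
    have h : shuffleWord σ = (List.ofFn σ).map fun i => decide (i.val < m) := by
      simp [shuffleWord, List.map_ofFn, Function.comp_def]
    rw [mem_boolWords, h, List.count, List.countP_map, List.count, List.countP_map]
    constructor
    · have := congrArg List.length (filter_ofFn_shuffle_left hσ)
      rw [← List.countP_eq_length_filter, List.length_ofFn] at this
      simpa [Function.comp_def] using this
    · have := congrArg List.length (filter_ofFn_shuffle_right hσ)
      rw [← List.countP_eq_length_filter, List.length_ofFn] at this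
      simpa [Function.comp_def] using this
  · intro σ hσ τ hτ h
    -- The list of values of a shuffle is the interleaving of its letters along its word.
    have h1 := ofFn_append_shuffle hσ (Fin.castAdd n) (Fin.natAdd m)
    have h2 := ofFn_append_shuffle hτ (Fin.castAdd n) (Fin.natAdd m)
    rw [h, ← h2] at h1
    have h3 : Fin.append (Fin.castAdd n) (Fin.natAdd m) = (id : Fin (m + n) → Fin (m + n)) :=
      Fin.append_castAdd_natAdd (f := id)
    rw [h3] at h1
    exact Equiv.ext fun i => congrFun (List.ofFn_injective h1) i
  · intro b hb
    rw [Finset.mem_coe, mem_boolWords] at hb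
    have hlen : b.length = m + n := by
      rw [← hb.1, ← hb.2, List.count_true_add_count_false]
    obtain ⟨p, rfl⟩ : ∃ p : Fin (m + n) → Bool, b = List.ofFn p :=
      ⟨fun i => b.get (i.cast hlen.symm), by
        rw [← List.ofFn_congr hlen b.get, List.ofFn_get]⟩
    rw [count_ofFn, count_ofFn] at hb
    have hc : (Finset.univ.filter fun i => p i = true)ᶜ =
        Finset.univ.filter fun i => p i = false := by
      ext i
      simp
    -- The shuffle puts the first `m` letters in the positions marked `true`.
    have hb2 : (Finset.univ.filter fun i => p i = true)ᶜ.card = n := by rw [hc, hb.2]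
    let e := finSumEquivOfFinset hb.1 hb2
    have he : ∀ j, p (e j) = j.isLeft := by
      rintro (j | j)
      · have := Finset.orderEmbOfFin_mem _ hb.1 j
        exact (Finset.mem_filter.1 this).2
      · have := Finset.orderEmbOfFin_mem _ hb2 j
        exact (Finset.mem_filter.1 (hc.le this)).2
    refine ⟨(finSumFinEquiv.symm.trans e).symm, ?_, ?_⟩
    · rw [Finset.mem_coe, mem_shuffles]
      constructor
      · intro i j h
        simpa [e] using h
      · intro i j h
        simpa [e] using h
    · rw [shuffleWord]
      congr 1
      funext i
      obtain ⟨j, rfl⟩ := e.surjective i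
      rw [he]
      cases j <;> simp

end Shuffles

section Product

variable {C : Type u} [CommRing C] {A : Type v} [CommRing A] [Algebra C A] (lam : C)

theorem mixableShuffleProduct_eq_quasiShuffle (x y : List A) :
    mixableShuffleProduct A lam (pureTensor C x) (pureTensor C y) = quasiShuffle lam x y := by
  rw [mixableShuffleProduct_pureTensor, mixableShuffles, Finset.sum_sigma,
    ← sum_mergeSum_interleave_eq_quasiShuffle, ← sum_shuffles]
  refine Finset.sum_congr rfl fun σ hσ => ?_
  have h := ofFn_append_shuffle hσ x.get y.get
  rw [List.ofFn_get, List.ofFn_get] at h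
  rw [← h, mergeSum, ← map_admissiblePairs]
  refine Finset.sum_nbij (fun T => T.map Fin.valEmbedding) ?_ ?_ ?_ ?_
  · intro T hT
    simpa using hT
  · exact fun _ _ _ _ h => Finset.map_injective _ h
  · intro T hT
    rw [Finset.mem_coe, Finset.mem_powerset, Finset.subset_map_iff] at hT
    obtain ⟨T', h, rfl⟩ := hT
    exact ⟨T', by simpa using h, rfl⟩
  · intro T _
    simp
end Product

/-! ### The mixable shuffle algebra -/

section MixableShuffleAlgebra

variable {C : Type u} [CommRing C] {A : Type v} [CommRing A] [Algebra C A]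

theorem lof_tprod {k : ℕ} (x : Fin k → A) :
    DirectSum.lof C ℕ (fun k => ⨂[C]^k A) k (PiTensorProduct.tprod C x) =
      pureTensor C (List.ofFn x) := by
  have h : ∀ (l : List A) (k : ℕ) (e : l.length = k),
      DirectSum.lof C ℕ (fun k => ⨂[C]^k A) k
        (PiTensorProduct.tprod C fun i => l.get (i.cast e.symm)) = pureTensor C l := by
    rintro l _ rfl
    rfl
  rw [← h (List.ofFn x) k List.length_ofFn]
  congr 2
  funext i
  simp

@[elab_as_elim]
theorem Tens.induction {p : Tens C A → Prop} (add : ∀ u v, p u → p v → p (u + v))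
    (smul : ∀ (c : C) u, p u → p (c • u)) (pure : ∀ l, p (pureTensor C l)) (u : Tens C A) :
    p u := by
  induction u using DirectSum.induction_on with
  | zero => simpa using smul 0 _ (pure [])
  | add u v hu hv => exact add u v hu hv
  | of k u =>
    induction u using PiTensorProduct.induction_on with
    | smul_tprod c x =>
      have := smul c _ (pure (List.ofFn x))
      rwa [← lof_tprod, ← map_smul] at this
    | add u v hu hv =>
      rw [map_add]
      exact add _ _ hu hv

theorem Tens.hom_ext {N : Type*} [AddCommGroup N] [Module C N] {f g : Tens C A →ₗ[C] N}
    (h : ∀ l, f (pureTensor C l) = g (pureTensor C l)) : f = g := by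
  refine LinearMap.ext fun u => ?_
  induction u using Tens.induction with
  | add u v hu hv => rw [map_add, map_add, hu, hv]
  | smul c u hu => rw [map_smul, map_smul, hu]
  | pure l => exact h l

variable (lam : C)

theorem mixableShuffleProduct_nil_left (u : Tens C A) :
    mixableShuffleProduct A lam (pureTensor C []) u = u := by
  have h : mixableShuffleProduct A lam (pureTensor C []) = LinearMap.id :=
    Tens.hom_ext fun l => by
      rw [mixableShuffleProduct_eq_quasiShuffle, quasiShuffle_nil_left, LinearMap.id_apply]
  rw [h, LinearMap.id_apply]

theorem mixableShuffleProduct_nil_right (u : Tens C A) :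
    mixableShuffleProduct A lam u (pureTensor C []) = u := by
  have h : (mixableShuffleProduct A lam).flip (pureTensor C []) = LinearMap.id :=
    Tens.hom_ext fun l => by
      rw [LinearMap.flip_apply, mixableShuffleProduct_eq_quasiShuffle, quasiShuffle_nil_right,
        LinearMap.id_apply]
  exact congrArg (fun f => f u) h

/-- The quasi-shuffle recursion of the mixable shuffle product. -/
theorem mixableShuffleProduct_prepend_prepend (a c : A) (u v : Tens C A) :
    mixableShuffleProduct A lam (prepend C A a u) (prepend C A c v) =
      prepend C A a (mixableShuffleProduct A lam u (prepend C A c v)) +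
      prepend C A c (mixableShuffleProduct A lam (prepend C A a u) v) +
      lam • prepend C A (a * c) (mixableShuffleProduct A lam u v) := by
  induction u using Tens.induction with
  | add u u' h h' =>
    simp only [map_add, LinearMap.add_apply, h, h', smul_add]
    abel
  | smul r u h =>
    simp only [map_smul, LinearMap.smul_apply, h, smul_add, smul_comm lam r]
  | pure x =>
    induction v using Tens.induction with
    | add v v' h h' =>
      simp only [map_add, h, h', smul_add]
      abel
    | smul r v h => simp only [map_smul, h, smul_add, smul_comm lam r]
    | pure y =>
      simp only [prepend_pureTensor, mixableShuffleProduct_eq_quasiShuffle,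
        quasiShuffle_cons_cons]

theorem mixableShuffleProduct_comm (u v : Tens C A) :
    mixableShuffleProduct A lam u v = mixableShuffleProduct A lam v u := by
  suffices h : mixableShuffleProduct A lam = (mixableShuffleProduct A lam).flip from
    congrArg (fun f => f u v) h
  refine Tens.hom_ext (N := Tens C A →ₗ[C] Tens C A) fun x => ?_
  refine Tens.hom_ext fun y => ?_
  rw [LinearMap.flip_apply]
  induction x generalizing y with
  | nil => rw [mixableShuffleProduct_nil_left, mixableShuffleProduct_nil_right]
  | cons a x ihx =>
    induction y with
    | nil => rw [mixableShuffleProduct_nil_left, mixableShuffleProduct_nil_right]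
    | cons c y ihy =>
      have h := ihx (c :: y)
      simp only [← prepend_pureTensor] at h ihy ⊢
      rw [mixableShuffleProduct_prepend_prepend, mixableShuffleProduct_prepend_prepend, h, ihy,
        ihx, mul_comm a c]
      abel

theorem mixableShuffleProduct_assoc_pureTensor (x y z : List A) :
    mixableShuffleProduct A lam
        (mixableShuffleProduct A lam (pureTensor C x) (pureTensor C y)) (pureTensor C z) =
      mixableShuffleProduct A lam (pureTensor C x)
        (mixableShuffleProduct A lam (pureTensor C y) (pureTensor C z)) := by
  induction x generalizing y z with
  | nil => simp only [mixableShuffleProduct_nil_left]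
  | cons a x ihx =>
    induction y generalizing z with
    | nil => simp only [mixableShuffleProduct_nil_left, mixableShuffleProduct_nil_right]
    | cons b y ihy =>
      induction z with
      | nil => simp only [mixableShuffleProduct_nil_right]
      | cons c z ihz =>
        have ha := ihx (b :: y) (c :: z)
        have hb := ihy (c :: z)
        have hab := ihx y (c :: z)
        have hac := ihx (b :: y) z
        have hbc := ihy z
        have habc := ihx y z
        simp only [← prepend_pureTensor] at ha hb hab hac hbc habc ihz ⊢
        rw [mixableShuffleProduct_prepend_prepend lam b c] at ha ⊢
        rw [mixableShuffleProduct_prepend_prepend lam a b] at ihz ⊢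
        simp only [map_add, LinearMap.add_apply, map_smul, LinearMap.smul_apply,
          mixableShuffleProduct_prepend_prepend, mul_assoc] at ha ihz ⊢
        have ha := congrArg (prepend C A a) ha
        have hz := congrArg (prepend C A c) ihz
        simp only [map_add, map_smul] at ha hz
        linear_combination (norm := module) ha + congrArg (prepend C A b) hb + hz +
          lam • congrArg (prepend C A (a * b)) hab + lam • congrArg (prepend C A (a * c)) hac +
          lam • congrArg (prepend C A (b * c)) hbc +
          lam • lam • congrArg (prepend C A (a * (b * c))) habc

theorem mixableShuffleProduct_assoc (u v w : Tens C A) :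
    mixableShuffleProduct A lam (mixableShuffleProduct A lam u v) w =
      mixableShuffleProduct A lam u (mixableShuffleProduct A lam v w) := by
  induction u using Tens.induction with
  | add _ _ h h' => simp only [map_add, LinearMap.add_apply, h, h']
  | smul _ _ h => simp only [map_smul, LinearMap.smul_apply, h]
  | pure x =>
    induction v using Tens.induction with
    | add _ _ h h' => simp only [map_add, LinearMap.add_apply, h, h']
    | smul _ _ h => simp only [map_smul, LinearMap.smul_apply, h]
    | pure y =>
      induction w using Tens.induction with
      | add _ _ h h' => simp only [map_add, h, h']
      | smul _ _ h => simp only [map_smul, h]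
      | pure z => exact mixableShuffleProduct_assoc_pureTensor lam x y z

end MixableShuffleAlgebra

/-! ### The Baxter algebra on the mixable shuffle algebra -/

section ShaAlgebra

variable {C : Type u} [CommRing C] {A : Type v} [CommRing A] [Algebra C A] (lam : C)

theorem Sha.mul_def (x y : Sha A lam) : x * y = Sha.mulMap A lam x y := rfl

theorem Sha.one_def : (1 : Sha A lam) = Sha.mk A lam 1 (pureTensor C []) := rfl

theorem Sha.op_mk_prepend (a : A) (u : Tens C A) :
    Sha.op A lam (Sha.mk A lam a u) = Sha.mk A lam 1 (prepend C A a u) := rfl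

variable {lam}

@[elab_as_elim]
theorem Sha.induction_mk {p : Sha A lam → Prop} (add : ∀ x y, p x → p y → p (x + y))
    (mk : ∀ a u, p (Sha.mk A lam a u)) (x : Sha A lam) : p x :=
  TensorProduct.induction_on (motive := fun x : A ⊗[C] Tens C A => p x) x
    ((TensorProduct.zero_tmul A (0 : Tens C A) : (0 : A) ⊗ₜ[C] (0 : Tens C A) = 0) ▸ mk 0 0) mk add

theorem Sha.mk_add (a : A) (u v : Tens C A) :
    Sha.mk A lam a (u + v) = Sha.mk A lam a u + Sha.mk A lam a v :=
  TensorProduct.tmul_add a u v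

theorem Sha.mk_smul (a : A) (c : C) (u : Tens C A) :
    Sha.mk A lam a (c • u) = c • Sha.mk A lam a u :=
  TensorProduct.tmul_smul c a u

theorem Sha.mk_sum (a : A) {ι : Type*} (s : Finset ι) (u : ι → Tens C A) :
    Sha.mk A lam a (∑ i ∈ s, u i) = ∑ i ∈ s, Sha.mk A lam a (u i) :=
  TensorProduct.tmul_sum a s u

theorem Sha.add_mk (a b : A) (u : Tens C A) :
    Sha.mk A lam (a + b) u = Sha.mk A lam a u + Sha.mk A lam b u :=
  TensorProduct.add_tmul a b u

theorem Sha.smul_mk (c : C) (a : A) (u : Tens C A) :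
    Sha.mk A lam (c • a) u = c • Sha.mk A lam a u :=
  TensorProduct.smul_tmul' c a u

theorem Sha.hom_ext {N : Type*} [AddCommGroup N] [Module C N] {f g : Sha A lam →ₗ[C] N}
    (h : ∀ a l, f (Sha.mk A lam a (pureTensor C l)) = g (Sha.mk A lam a (pureTensor C l))) :
    f = g := by
  refine LinearMap.ext fun x => ?_
  induction x using Sha.induction_mk with
  | add x y hx hy => rw [map_add, map_add, hx, hy]
  | mk a u =>
    induction u using Tens.induction with
    | add u v hu hv => rw [Sha.mk_add, map_add, map_add, hu, hv]
    | smul c u hu => rw [Sha.mk_smul, map_smul, map_smul, hu]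
    | pure l => exact h a l

theorem Sha.add_mul (x y z : Sha A lam) : (x + y) * z = x * z + y * z := by
  simp only [Sha.mul_def, map_add, LinearMap.add_apply]

theorem Sha.mul_add (x y z : Sha A lam) : x * (y + z) = x * y + x * z := by
  simp only [Sha.mul_def, map_add]

variable (A lam)

/-- `Ш_C(A)` is a Baxter algebra of any weight: `(1 ⊗ a ⊗ u) ⋄ (1 ⊗ b ⊗ v)` expands by the
quasi-shuffle recursion into the three terms of the Baxter identity. -/
theorem isBaxterAlgebra_sha : IsBaxterAlgebra lam (Sha.op A lam) where
  mul_assoc x y z := by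
    induction x using Sha.induction_mk with
    | add x x' h h' => simp only [Sha.add_mul, h, h']
    | mk a u =>
      induction y using Sha.induction_mk with
      | add y y' h h' => simp only [Sha.add_mul, Sha.mul_add, h, h']
      | mk b v =>
        induction z using Sha.induction_mk with
        | add z z' h h' => simp only [Sha.mul_add, h, h']
        | mk c w => simp only [Sha.mk_mul_mk, mul_assoc, mixableShuffleProduct_assoc]
  mul_comm x y := by
    induction x using Sha.induction_mk with
    | add x x' h h' => simp only [Sha.add_mul, Sha.mul_add, h, h']
    | mk a u =>
      induction y using Sha.induction_mk with
      | add y y' h h' => simp only [Sha.add_mul, Sha.mul_add, h, h']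
      | mk b v => rw [Sha.mk_mul_mk, Sha.mk_mul_mk, mul_comm, mixableShuffleProduct_comm]
  add_mul := Sha.add_mul
  smul_mul c x y := by simp only [Sha.mul_def, map_smul, LinearMap.smul_apply]
  baxter x y := by
    induction x using Sha.induction_mk with
    | add x x' h h' =>
      simp only [Sha.add_mul, Sha.mul_add, map_add, h, h', smul_add]
      abel
    | mk a u =>
      induction y using Sha.induction_mk with
      | add y y' h h' =>
        simp only [Sha.add_mul, Sha.mul_add, map_add, h, h', smul_add]
        abel
      | mk b v =>
        simp only [Sha.op_mk_prepend, Sha.mk_mul_mk, mixableShuffleProduct_prepend_prepend,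
          Sha.mk_add, Sha.mk_smul, mul_one]
        rw [mixableShuffleProduct_comm lam v]
  one_mul x := by
    induction x using Sha.induction_mk with
    | add x x' h h' => rw [Sha.mul_add, h, h']
    | mk a u => rw [Sha.one_def, Sha.mk_mul_mk, one_mul, mixableShuffleProduct_nil_left]

end ShaAlgebra

/-! ### Linear maps defined by recursion on the first letter -/

section Foldr

variable {C : Type u} [CommRing C] {A : Type v} [CommRing A] [Algebra C A]
  {N : Type w} [AddCommGroup N] [Module C N]

/-- The multilinear map `(a₁, …, aₖ) ↦ θ a₁ (θ a₂ (⋯ (θ aₖ n)))`. -/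
def foldrMultilinear (θ : A →ₗ[C] N →ₗ[C] N) (n : N) :
    ∀ k : ℕ, MultilinearMap C (fun _ : Fin k => A) N
  | 0 => MultilinearMap.constOfIsEmpty C _ n
  | k + 1 => LinearMap.uncurryLeft (M := fun _ : Fin (k + 1) => A)
      { toFun := fun a => (θ a).compMultilinearMap (foldrMultilinear θ n k)
        map_add' := fun a b => by
          ext x
          simp
        map_smul' := fun c a => by
          ext x
          simp }

/-- The linear map `a₁ ⊗ ⋯ ⊗ aₖ ↦ θ a₁ (θ a₂ (⋯ (θ aₖ n)))`. -/
def Tens.foldr (θ : A →ₗ[C] N →ₗ[C] N) (n : N) : Tens C A →ₗ[C] N :=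
  DirectSum.toModule C ℕ N fun k => PiTensorProduct.lift (foldrMultilinear θ n k)

theorem Tens.foldr_pureTensor (θ : A →ₗ[C] N →ₗ[C] N) (n : N) (l : List A) :
    Tens.foldr θ n (pureTensor C l) = foldrMultilinear θ n l.length l.get := by
  rw [Tens.foldr, pureTensor, DirectSum.toModule_lof, PiTensorProduct.lift.tprod]

theorem Tens.foldr_nil (θ : A →ₗ[C] N →ₗ[C] N) (n : N) :
    Tens.foldr θ n (pureTensor C []) = n := by
  rw [Tens.foldr_pureTensor]
  rfl

theorem Tens.foldr_prepend (θ : A →ₗ[C] N →ₗ[C] N) (n : N) (a : A) (u : Tens C A) :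
    Tens.foldr θ n (prepend C A a u) = θ a (Tens.foldr θ n u) := by
  suffices h : Tens.foldr θ n ∘ₗ prepend C A a = θ a ∘ₗ Tens.foldr θ n from
    congrArg (fun f => f u) h
  refine Tens.hom_ext fun l => ?_
  rw [LinearMap.comp_apply, LinearMap.comp_apply, prepend_pureTensor, Tens.foldr_pureTensor,
    Tens.foldr_pureTensor]
  rfl

end Foldr

/-! ### Cartier's product as a sum over words -/

section Triples

/-- The word with letters from `x` in the positions where `b` is `true`, in order, and `1` in the
other positions. -/
def fill {B : Type*} [One B] : List Bool → List B → List B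
  | [], _ => []
  | true :: b, a :: x => a :: fill b x
  | true :: _, [] => []
  | false :: b, x => 1 :: fill b x

theorem fill_map_filter {L B : Type*} [One B] (p : L → Bool) (g : L → B)
    (hg : ∀ i, p i = false → g i = 1) (l : List L) :
    l.map g = fill (l.map p) ((l.filter p).map g) := by
  induction l with
  | nil => rfl
  | cons a l ih => cases h : p a <;> simp [h, hg, fill, ← ih]

/-- The word whose letter in each position is the next letter of `x`, the next letter of `y`, or
the product of both, according to the entry `(true, false)`, `(false, true)` or `(true, true)` of
`s`. -/
def stepMerge {B : Type*} [MulOneClass B] (s : List (Bool × Bool)) (x y : List B) : List B :=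
  List.zipWith (· * ·) (fill (s.map Prod.fst) x) (fill (s.map Prod.snd) y)

section StepMerge

variable {B : Type*} [MulOneClass B] (s : List (Bool × Bool)) (a c : B) (x y : List B)

theorem stepMerge_nil : stepMerge [] x y = [] := rfl

theorem stepMerge_left : stepMerge ((true, false) :: s) (a :: x) y = a :: stepMerge s x y := by
  simp [stepMerge, fill]

theorem stepMerge_right : stepMerge ((false, true) :: s) x (c :: y) = c :: stepMerge s x y := by
  simp [stepMerge, fill]

theorem stepMerge_both :
    stepMerge ((true, true) :: s) (a :: x) (c :: y) = (a * c) :: stepMerge s x y := by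
  simp [stepMerge, fill]

end StepMerge

/-- Cartier's signed sum satisfies the quasi-shuffle recursion of weight `-1`: an entry
`(true, true)` shortens the result by one letter, which changes the sign. -/
theorem sum_stepMerge_eq_quasiShuffle {C : Type u} [CommRing C] {A : Type v} [CommRing A]
    [Algebra C A] {B : Type*} [MulOneClass B] (g : B → A) (hg : ∀ a b, g (a * b) = g a * g b)
    (x y : List B) :
    ∑ s ∈ stepWords x.length y.length, ((-1) ^ (s.length + x.length + y.length) : C) •
        pureTensor C ((stepMerge s x y).map g) = quasiShuffle (-1 : C) (x.map g) (y.map g) := by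
  induction x generalizing y with
  | nil =>
    rw [List.map_nil, quasiShuffle_nil_left]
    induction y with
    | nil => simp [stepWords, stepMerge_nil]
    | cons c y ih =>
      have e : ∀ i : ℕ, (-1 : C) ^ (i + 1 + 0 + (y.length + 1)) = (-1) ^ (i + 0 + y.length) :=
        fun i => by ring
      simp only [List.length_nil] at ih
      simp only [List.length_cons, List.length_nil, stepWords, Finset.sum_map,
        Function.Embedding.coeFn_mk, stepMerge_right, e, List.map_cons, ← prepend_pureTensor,
        ← map_smul, ← map_sum, ih]
  | cons a x ihx =>
    induction y with
    | nil =>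
      have e : ∀ i : ℕ, (-1 : C) ^ (i + 1 + (x.length + 1) + 0) = (-1) ^ (i + x.length + 0) :=
        fun i => by ring
      have h := ihx []
      simp only [List.length_nil, List.map_nil, quasiShuffle_nil_right] at h ⊢
      simp only [List.length_cons, stepWords, Finset.sum_map,
        Function.Embedding.coeFn_mk, stepMerge_left, e, List.map_cons, ← prepend_pureTensor,
        ← map_smul, ← map_sum, h]
    | cons c y ihy =>
      have h1 := ihx (c :: y)
      have h2 := ihx y
      have e1 : ∀ i : ℕ, (-1 : C) ^ (i + 1 + (x.length + 1) + (y.length + 1)) =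
        (-1) ^ (i + x.length + (y.length + 1)) := fun i => by ring
      have e2 : ∀ i : ℕ, (-1 : C) ^ (i + 1 + (x.length + 1) + (y.length + 1)) =
        (-1) ^ (i + (x.length + 1) + y.length) := fun i => by ring
      have e3 : ∀ i : ℕ, (-1 : C) ^ (i + 1 + (x.length + 1) + (y.length + 1)) =
        (-1) * (-1) ^ (i + x.length + y.length) := fun i => by ring
      simp only [List.length_cons, List.map_cons] at h1 ihy ⊢
      rw [sum_stepWords_succ_succ, quasiShuffle_cons_cons, ← h1, ← h2, ← ihy]
      simp only [List.length_cons, stepMerge_left, stepMerge_right, stepMerge_both, List.map_cons,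
        map_sum, map_smul, Finset.smul_sum, prepend_pureTensor, smul_smul, hg]
      exact congrArg₂ _ (congrArg₂ _ (Finset.sum_congr rfl fun s _ => by rw [e1])
        (Finset.sum_congr rfl fun s _ => by rw [e2])) (Finset.sum_congr rfl fun s _ => by rw [e3])

variable {X : Type v} {m n : ℕ}

/-- The word of a triple `(k, P, Q)`: it records for each position whether it is in `P` and whether
it is in `Q`. -/
def Triple.stepWord (t : Triple m n) : List (Bool × Bool) :=
  List.ofFn fun j => (decide (j ∈ t.P), decide (j ∈ t.Q))

theorem Triple.length_stepWord (t : Triple m n) : t.stepWord.length = t.k :=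
  List.length_ofFn

/-- The word with the letter `a α` in the `α`-th position of `P` and `1` outside of `P`. -/
theorem ofFn_rank {B : Type*} [One B] {k r : ℕ} (P : Finset (Fin k)) (hP : P.card = r)
    (a : Fin r → B) :
    (List.ofFn fun j => if h : j ∈ P then a ((P.orderIsoOfFin hP).symm ⟨j, h⟩) else 1) =
      fill (List.ofFn fun j => decide (j ∈ P)) (List.ofFn a) := by
  have h := fill_map_filter (fun j => decide (j ∈ P))
    (fun j => if h : j ∈ P then a ((P.orderIsoOfFin hP).symm ⟨j, h⟩) else 1)
    (fun j hj => dif_neg (by simpa using hj)) (List.ofFn (Equiv.refl (Fin k)))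
  rw [filter_ofFn_perm (Equiv.refl (Fin k)) _ (P.orderEmbOfFin hP)
    (fun i j h => by simpa using h)] at h
  · rw [List.map_ofFn, List.map_ofFn, List.map_ofFn] at h
    refine h.trans (congrArg _ (congrArg _ (funext fun i => ?_)))
    rw [Function.comp_apply, dif_pos (P.orderEmbOfFin_mem hP i)]
    congr 1
    exact (P.orderIsoOfFin hP).symm_apply_apply i
  · intro j
    have := Finset.range_orderEmbOfFin P hP
    rw [decide_eq_true_eq, ← Finset.mem_coe, ← this, Set.mem_range]

theorem Triple.word_eq_stepMerge (t : Triple m n) (a : Fin m → Mon X) (b : Fin n → Mon X) :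
    t.word a b = stepMerge t.stepWord (List.ofFn a) (List.ofFn b) := by
  rw [stepMerge, stepWord, List.map_ofFn, List.map_ofFn]
  have hP := ofFn_rank t.P t.cardP a
  have hQ := ofFn_rank t.Q t.cardQ b
  simp only [Function.comp_def]
  rw [← hP, ← hQ, Triple.word]
  apply List.ext_getElem
  · simp
  · intro i h1 h2
    simp [Triple.letter]

theorem length_le_of_mem_stepWords {s : List (Bool × Bool)} (hs : s ∈ stepWords m n) :
    s.length ≤ m + n := by
  rw [mem_stepWords] at hs
  obtain ⟨rfl, rfl, hs⟩ := hs
  induction s with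
  | nil => simp
  | cons a s ih =>
    obtain ⟨a, b⟩ := a
    have := ih fun h => hs (List.mem_cons_of_mem _ h)
    cases a <;> cases b <;> simp at hs ⊢ <;> omega

/-- Taking words is a bijection from the triples `(k, P, Q)` to `stepWords m n`. For `m = n = 0` it
is not, since then the empty word would need `k = 0`. -/
theorem sum_triple {N : Type*} [AddCommMonoid N] (hm : m ≠ 0) (F : List (Bool × Bool) → N) :
    ∑ t : Triple m n, F t.stepWord = ∑ s ∈ stepWords m n, F s := by
  refine Finset.sum_nbij Triple.stepWord ?_ ?_ ?_ fun _ _ => rfl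
  · intro t _
    have hcard : ∀ S : Finset (Fin t.k), (Finset.univ.filter fun j => decide (j ∈ S) = true) = S :=
      fun S => by
        ext
        simp
    rw [mem_stepWords, Triple.stepWord, List.map_ofFn, List.map_ofFn]
    simp only [Function.comp_def]
    rw [count_ofFn, count_ofFn, hcard, hcard]
    refine ⟨t.cardP, t.cardQ, ?_⟩
    rw [List.mem_ofFn]
    rintro ⟨j, hj⟩
    have hu : j ∈ t.P ∪ t.Q := t.union ▸ Finset.mem_univ j
    rw [Finset.mem_union] at hu
    simp only [Prod.mk.injEq, decide_eq_false_iff_not] at hj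
    exact hu.elim hj.1 hj.2
  · rintro ⟨k, _, P, Q, _, _, _⟩ _ ⟨k', _, P', Q', _, _, _⟩ _ h
    obtain rfl : k = k' := Fin.ext (by simpa [Triple.stepWord] using congrArg List.length h)
    have h' := List.ofFn_injective h
    have hP : P = P' := by
      ext j
      simpa using (Prod.ext_iff.1 (congrFun h' j)).1
    have hQ : Q = Q' := by
      ext j
      simpa using (Prod.ext_iff.1 (congrFun h' j)).2
    subst hP hQ
    rfl
  · intro s hs
    have hlen := length_le_of_mem_stepWords hs
    rw [Finset.mem_coe, mem_stepWords] at hs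
    obtain ⟨k, hk⟩ : ∃ k, s.length = k := ⟨_, rfl⟩
    obtain ⟨p, rfl⟩ : ∃ p : Fin k → Bool × Bool, s = List.ofFn p :=
      ⟨fun i => s.get (i.cast hk.symm), by rw [← List.ofFn_congr hk s.get, List.ofFn_get]⟩
    rw [List.map_ofFn, List.map_ofFn, count_ofFn, count_ofFn, List.mem_ofFn] at hs
    obtain ⟨h1, h2, h3⟩ := hs
    have hpos : 1 ≤ k := by
      by_contra hk0
      obtain rfl : k = 0 := by omega
      simp at h1
      exact hm h1.symm
    refine ⟨⟨⟨k, by omega⟩, hpos, Finset.univ.filter fun i => (p i).1 = true,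
      Finset.univ.filter fun i => (p i).2 = true, ?_, h1, h2⟩,
      Finset.mem_coe.2 (Finset.mem_univ _), ?_⟩
    · ext i
      have := fun h => h3 ⟨i, h⟩
      simp only [Prod.ext_iff] at this
      cases h : (p i).1 <;> simp_all
    · rw [Triple.stepWord]
      congr 1
      funext i
      simp

end Triples

/-! ### The morphism from Cartier's Baxter algebra -/

section ToSha

variable {C : Type u} [CommRing C] {X : Type v}

theorem Cartier.hom_ext {N : Type*} [AddCommGroup N] [Module C N] {f g : Cartier C X →ₗ[C] N}
    (h : ∀ w, f (Cartier.of C w) = g (Cartier.of C w)) : f = g :=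
  Finsupp.lhom_ext' (M := C) (α := Symb X) fun w => LinearMap.ext_ring (h w)

theorem mon_one : mon C (1 : Mon X) = 1 := rfl

theorem mon_mul (u v : Mon X) : mon C (u * v) = mon C u * mon C v := by
  rw [mon, mon, mon, MvPolynomial.monomial_mul, one_mul]
  rfl

/-- The symbol `u · [u₁, …, uₘ]`, where `l` is the word `u₁, …, uₘ`. -/
def Symb.mk (u : Mon X) (l : List (Mon X)) (h : (u :: l).getLast (List.cons_ne_nil _ _) ≠ 1) :
    Symb X := ⟨(u, l), h⟩

@[elab_as_elim]
theorem Symb.induction_mk {p : Symb X → Prop} (mk : ∀ u l h, p (Symb.mk u l h)) (w : Symb X) :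
    p w := mk w.1.1 w.1.2 w.2

/-- The symbol `u · [ ]`. -/
def Symb.ofMon (u : Mon X) (hu : u ≠ 1) : Symb X := Symb.mk u [] (by rwa [List.getLast_singleton])

theorem Symb.op_mk (u : Mon X) (l : List (Mon X)) (h) :
    (Symb.mk u l h).op =
      Symb.mk 1 (u :: l) (by rwa [List.getLast_cons (List.cons_ne_nil _ _)]) := rfl

theorem Symb.mul_mk_of_left_nil (u v : Mon X) (l : List (Mon X)) (hu hv) :
    Symb.mul C (Symb.mk u [] hu) (Symb.mk v l hv) =
      Cartier.of C (Symb.mk (u * v) l (getLast_head_mul_ne_one u hv)) :=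
  dif_pos rfl

theorem Symb.mul_mk_of_right_nil (u v : Mon X) (k : List (Mon X)) (hk : k ≠ []) (hu hv) :
    ∃ h, Symb.mul C (Symb.mk u k hu) (Symb.mk v [] hv) = Cartier.of C (Symb.mk (u * v) k h) :=
  ⟨_, (dif_neg hk).trans (dif_pos rfl)⟩

theorem Symb.mul_mk (u v : Mon X) (k l : List (Mon X)) (hk : k ≠ []) (hl : l ≠ []) (hu hv) :
    ∃ h : ∀ t : Triple k.length l.length,
        (u * v :: t.word k.get l.get).getLast (List.cons_ne_nil _ _) ≠ 1,
      Symb.mul C (Symb.mk u k hu) (Symb.mk v l hv) =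
      ∑ t : Triple k.length l.length, ((-1) ^ (t.k.val + t.P.card + t.Q.card) : C) •
        Cartier.of C (Symb.mk (u * v) (t.word k.get l.get) (h t)) :=
  ⟨_, (dif_neg hk).trans (dif_neg hl)⟩

theorem toSha_mk (u : Mon X) (l : List (Mon X)) (h) :
    toSha C X (Cartier.of C (Symb.mk u l h)) =
      Sha.mk (MvPolynomial X C) (-1 : C) (mon C u) (pureTensor C (l.map (mon C))) :=
  Cartier.lift_of C _ _

theorem toSha_ofMon (u : Mon X) (hu) :
    toSha C X (Cartier.of C (Symb.ofMon u hu)) =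
      Sha.mk (MvPolynomial X C) (-1 : C) (mon C u) (pureTensor C []) :=
  toSha_mk u [] _

theorem Cartier.op_of (w : Symb X) :
    Cartier.op C X (Cartier.of C w) = Cartier.of C w.op :=
  Cartier.lift_of C _ w

theorem toSha_op (x : Cartier C X) :
    toSha C X (Cartier.op C X x) = ShaOn.op C X (toSha C X x) := by
  suffices h : toSha C X ∘ₗ Cartier.op C X = ShaOn.op C X ∘ₗ toSha C X from
    congrArg (fun f => f x) h
  refine Cartier.hom_ext fun w => ?_
  induction w using Symb.induction_mk with
  | mk u l h =>
    rw [LinearMap.comp_apply, LinearMap.comp_apply, Cartier.op_of, Symb.op_mk, toSha_mk, toSha_mk,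
      Sha.op_mk, mon_one, List.map_cons]

theorem toSha_symb_mul (w v : Symb X) :
    toSha C X (Symb.mul C w v) = toSha C X (Cartier.of C w) * toSha C X (Cartier.of C v) := by
  induction w using Symb.induction_mk with
  | mk u k hu =>
  induction v using Symb.induction_mk with
  | mk v l hv =>
  rw [toSha_mk, toSha_mk, Sha.mk_mul_mk, mixableShuffleProduct_eq_quasiShuffle, ← mon_mul]
  by_cases hk : k = []
  · subst hk
    rw [Symb.mul_mk_of_left_nil, toSha_mk, List.map_nil, quasiShuffle_nil_left]
  · by_cases hl : l = []
    · subst hl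
      obtain ⟨h, e⟩ := Symb.mul_mk_of_right_nil (C := C) u v k hk hu hv
      rw [e, toSha_mk, List.map_nil, quasiShuffle_nil_right]
    · obtain ⟨h, e⟩ := Symb.mul_mk (C := C) u v k l hk hl hu hv
      have hlen : k.length ≠ 0 := fun h => hk (List.length_eq_zero_iff.1 h)
      rw [e, ← sum_stepMerge_eq_quasiShuffle (mon C) mon_mul, ← sum_triple hlen, map_sum,
        Sha.mk_sum]
      refine Finset.sum_congr rfl fun t _ => ?_
      rw [Sha.mk_smul, map_smul, toSha_mk, t.word_eq_stepMerge, List.ofFn_get, List.ofFn_get,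
        t.cardP, t.cardQ, t.length_stepWord]

theorem Cartier.mul_def (x y : Cartier C X) : x * y = Cartier.mulMap C X x y := rfl

theorem toSha_mul (x y : Cartier C X) : toSha C X (x * y) = toSha C X x * toSha C X y := by
  suffices h : (Cartier.mulMap C X).compr₂ (toSha C X) =
      (Sha.mulMap (MvPolynomial X C) (-1 : C)).compl₁₂ (toSha C X) (toSha C X) from
    congrArg (fun f => f x y) h
  refine Cartier.hom_ext fun w => Cartier.hom_ext fun v => ?_
  rw [LinearMap.compr₂_apply, LinearMap.compl₁₂_apply, ← Cartier.mul_def, ← Sha.mul_def,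
    Cartier.of_mul_of, toSha_symb_mul]

/-- The linear map on `C[X]` with prescribed values on the monomials. -/
def monLift {N : Type*} [AddCommGroup N] [Module C N] (g : Mon X → N) : MvPolynomial X C →ₗ[C] N :=
  (MvPolynomial.basisMonomials X C).constr C fun u => g (Multiplicative.ofAdd u)

theorem monLift_mon {N : Type*} [AddCommGroup N] [Module C N] (g : Mon X → N) (u : Mon X) :
    monLift g (mon C u) = g u := by
  have h := (MvPolynomial.basisMonomials X C).constr_basis C
    (fun u => g (Multiplicative.ofAdd u)) (Multiplicative.toAdd u)
  rw [MvPolynomial.coe_basisMonomials] at h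
  exact h

variable (C X)

/-- The linear map `u₁ ⊗ ⋯ ⊗ uₘ ↦ [u₁, …, uₘ]` for monomials `uᵢ`. -/
def Tens.toWords : Tens C (MvPolynomial X C) →ₗ[C] (List (Mon X) →₀ C) :=
  Tens.foldr (monLift fun u => Finsupp.lmapDomain C C (List.cons u)) (Finsupp.single [] 1)

/-- The linear map `u₀ ⊗ u₁ ⊗ ⋯ ⊗ uₘ ↦ (u₀, [u₁, …, uₘ])` for monomials `uᵢ`. -/
def Sha.toWords : ShaOn C X →ₗ[C] (Mon X × List (Mon X) →₀ C) :=
  TensorProduct.lift ((monLift fun u => Finsupp.lmapDomain C C (Prod.mk u)).compl₂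
    (Tens.toWords C X))

variable {C X}

theorem Tens.toWords_pureTensor (l : List (Mon X)) :
    Tens.toWords C X (pureTensor C (l.map (mon C))) = Finsupp.single l 1 := by
  induction l with
  | nil => exact Tens.foldr_nil _ _
  | cons u l ih =>
    rw [Tens.toWords] at ih ⊢
    rw [List.map_cons, ← prepend_pureTensor, Tens.foldr_prepend, ih, monLift_mon,
      Finsupp.lmapDomain_apply, Finsupp.mapDomain_single]

theorem Sha.toWords_mk (a : MvPolynomial X C) (u : Tens C (MvPolynomial X C)) :
    Sha.toWords C X (Sha.mk _ _ a u) =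
      monLift (fun u => Finsupp.lmapDomain C C (Prod.mk u)) a (Tens.toWords C X u) := rfl

/-- `Sha.toWords ∘ toSha` is the inclusion of the symbols into all words, linearly extended. -/
theorem toSha_injective : Function.Injective (toSha C X) := by
  have h : Sha.toWords C X ∘ₗ toSha C X =
      (Finsupp.lmapDomain C C Subtype.val : (Symb X →₀ C) →ₗ[C] _) := by
    refine Cartier.hom_ext fun w => ?_
    have hw := (Finsupp.mapDomain_single (f := Subtype.val) (a := w) (b := (1 : C))).symm
    refine Eq.trans ?_ hw
    induction w using Symb.induction_mk with
    | mk u l h =>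
      rw [LinearMap.comp_apply, toSha_mk, Sha.toWords_mk, monLift_mon, Tens.toWords_pureTensor,
        Finsupp.lmapDomain_apply, Finsupp.mapDomain_single]
      rfl
  have hinj : Function.Injective (Sha.toWords C X ∘ₗ toSha C X) := by
    rw [h]
    exact Finsupp.mapDomain_injective Subtype.val_injective
  exact Function.Injective.of_comp (f := Sha.toWords C X) hinj

variable (C X)

/-- The axioms of `𝔅(X)` are those of `Ш_C(X)`, restricted along the injection `toSha`. -/
theorem isNonUnitalBaxterAlgebra_cartier :
    IsNonUnitalBaxterAlgebra (-1 : C) (Cartier.op C X) := by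
  have H := isBaxterAlgebra_sha (MvPolynomial X C) (-1 : C)
  refine ⟨fun x y z => toSha_injective ?_, fun x y => toSha_injective ?_,
    fun x y z => toSha_injective ?_, fun c x y => toSha_injective ?_,
    fun x y => toSha_injective ?_⟩
  · simp only [toSha_mul, H.mul_assoc]
  · simp only [toSha_mul, H.mul_comm (toSha C X x)]
  · simp only [toSha_mul, map_add, H.add_mul]
  · simp only [toSha_mul, map_smul, H.smul_mul]
  · simp only [toSha_mul, toSha_op, map_add, map_smul, H.baxter (toSha C X x)]

end ToSha

/-! ### The universal property -/

section Universal

variable {C : Type u} [CommRing C]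

section Extension

variable {A' : Type v} [CommRing A'] [Algebra C A'] {A : Type w} [CommRing A] [Algebra C A]
  (g : A' →ₐ[C] A) (P : A →ₗ[C] A)

/-- The linear map `a₁ ⊗ ⋯ ⊗ aₖ ↦ P (g a₁ P (g a₂ ⋯ P (g aₖ)))`. -/
def Tens.extend : Tens C A' →ₗ[C] A :=
  Tens.foldr ((LinearMap.mul C A).compr₂ P ∘ₗ g.toLinearMap) 1

theorem Tens.extend_nil : Tens.extend g P (pureTensor C []) = 1 := Tens.foldr_nil _ _

theorem Tens.extend_prepend (a : A') (u : Tens C A') :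
    Tens.extend g P (prepend C A' a u) = P (g a * Tens.extend g P u) :=
  Tens.foldr_prepend _ _ a u

variable {P} in
theorem Tens.extend_mixableShuffleProduct {lam : C} (hP : IsBaxterOperator lam P)
    (u v : Tens C A') :
    Tens.extend g P (mixableShuffleProduct A' lam u v) =
      Tens.extend g P u * Tens.extend g P v := by
  suffices h : (mixableShuffleProduct A' lam).compr₂ (Tens.extend g P) =
      (LinearMap.mul C A).compl₁₂ (Tens.extend g P) (Tens.extend g P) from
    congrArg (fun f => f u v) h
  refine Tens.hom_ext (N := Tens C A' →ₗ[C] A) fun x => ?_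
  refine Tens.hom_ext fun y => ?_
  rw [LinearMap.compr₂_apply, LinearMap.compl₁₂_apply, LinearMap.mul_apply']
  induction x generalizing y with
  | nil => rw [mixableShuffleProduct_nil_left, Tens.extend_nil, one_mul]
  | cons a x ihx =>
    induction y with
    | nil => rw [mixableShuffleProduct_nil_right, Tens.extend_nil, mul_one]
    | cons c y ihy =>
      have h := ihx (c :: y)
      simp only [← prepend_pureTensor] at h ihy ⊢
      rw [mixableShuffleProduct_prepend_prepend, map_add, map_add, map_smul]
      simp only [Tens.extend_prepend] at h ihy ⊢
      rw [h, ihy, ihx, hP, map_mul g, mul_mul_mul_comm, ← mul_assoc (g a),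
        mul_left_comm (g c), mul_comm (P _) (g c * _)]

/-- The extension `a₀ ⊗ a₁ ⊗ ⋯ ⊗ aₖ ↦ g a₀ P (g a₁ P (g a₂ ⋯ P (g aₖ)))` to `Ш_C` of an algebra
homomorphism `g`. -/
def Sha.extend (lam : C) : Sha A' lam →ₗ[C] A :=
  TensorProduct.lift ((LinearMap.mul C A).compl₁₂ g.toLinearMap (Tens.extend g P))

theorem Sha.extend_mk {lam : C} (a : A') (u : Tens C A') :
    Sha.extend g P lam (Sha.mk A' lam a u) = g a * Tens.extend g P u := rfl

variable {P} in
theorem isBaxterHom_extend {lam : C} (hP : IsBaxterOperator lam P) :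
    IsBaxterHom (Sha.op A' lam) P (Sha.extend g P lam) where
  map_mul x y := by
    induction x using Sha.induction_mk with
    | add x x' h h' => rw [Sha.add_mul, map_add, h, h', map_add, add_mul]
    | mk a u =>
      induction y using Sha.induction_mk with
      | add y y' h h' => rw [Sha.mul_add, map_add, h, h', map_add, mul_add]
      | mk b v =>
        rw [Sha.mk_mul_mk, Sha.extend_mk, Sha.extend_mk, Sha.extend_mk, map_mul,
          Tens.extend_mixableShuffleProduct g hP]
        ring
  map_op x := by
    induction x using Sha.induction_mk with
    | add x x' h h' => rw [map_add, map_add, h, h', map_add, map_add]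
    | mk a u =>
      rw [Sha.op_mk_prepend, Sha.extend_mk, Sha.extend_mk, map_one, one_mul, Tens.extend_prepend]
  map_one := by rw [Sha.one_def, Sha.extend_mk, Tens.extend_nil, map_one, one_mul]

end Extension

variable {X : Type v} {A : Type w} [CommRing A] [Algebra C A] {P : A →ₗ[C] A}

/-- Two morphisms out of `𝔅(X)` that agree on the symbols `u · [ ]` are equal: with these, the
products and the operator one obtains all symbols, as
`u₀ · [u₁, …, uₘ] = (u₀ · [ ]) P (u₁ · [u₂, …, uₘ])`. -/
theorem cartier_hom_ext {φ ψ : Cartier C X →ₗ[C] A} (hφ : IsNonUnitalBaxterHom (Cartier.op C X) P φ)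
    (hψ : IsNonUnitalBaxterHom (Cartier.op C X) P ψ)
    (h : ∀ u hu, φ (Cartier.of C (Symb.ofMon u hu)) = ψ (Cartier.of C (Symb.ofMon u hu))) :
    φ = ψ := by
  refine Cartier.hom_ext fun w => ?_
  induction w using Symb.induction_mk with
  | mk u l hw =>
  induction l generalizing u with
  | nil => exact h u hw
  | cons v l ih =>
    have hv : (v :: l).getLast (List.cons_ne_nil _ _) ≠ 1 := by
      rwa [List.getLast_cons (List.cons_ne_nil _ _)] at hw
    have hop : φ (Cartier.of C (Symb.mk v l hv).op) = ψ (Cartier.of C (Symb.mk v l hv).op) := by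
      rw [← Cartier.op_of, hφ.map_op, hψ.map_op, ih]
    by_cases hu : u = 1
    · subst hu
      exact hop
    · have hmul : Cartier.of C (Symb.ofMon u hu) * Cartier.of C (Symb.mk v l hv).op =
          Cartier.of C (Symb.mk u (v :: l) hw) := by
        rw [Cartier.of_mul_of, Symb.op_mk, Symb.ofMon, Symb.mul_mk_of_left_nil]
        simp only [mul_one]
      rw [← hmul, hφ.map_mul, hψ.map_mul, hop, h]

theorem Cartier.of_ofMon_mul {u v : Mon X} (hu : u ≠ 1) (hv : v ≠ 1) :
    Cartier.of C (Symb.ofMon u hu) * Cartier.of C (Symb.ofMon v hv) =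
      Cartier.of C (Symb.ofMon (u * v) (Mon.mul_ne_one (Or.inl hu))) := by
  rw [Cartier.of_mul_of, Symb.ofMon, Symb.ofMon, Symb.mul_mk_of_left_nil]
  rfl

/-- A multiplicative map on `𝔅(X)` induces an algebra homomorphism on `C[X]`, as it is
multiplicative on the monomials `u ≠ 1`. -/
theorem exists_algHom_mon (φ : Cartier C X →ₗ[C] A) (hφ : ∀ x y, φ (x * y) = φ x * φ y) :
    ∃ g : MvPolynomial X C →ₐ[C] A,
      ∀ u hu, g (mon C u) = φ (Cartier.of C (Symb.ofMon u hu)) := by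
  classical
  let q : Mon X →* A :=
    { toFun := fun u => if hu : u = 1 then 1 else φ (Cartier.of C (Symb.ofMon u hu))
      map_one' := dif_pos rfl
      map_mul' := fun u v => by
        by_cases hu : u = 1
        · subst hu
          simp
        · by_cases hv : v = 1
          · subst hv
            simp
          · rw [dif_neg hu, dif_neg hv, dif_neg (Mon.mul_ne_one (Or.inl hu)), ← hφ,
              Cartier.of_ofMon_mul] }
  -- `MvPolynomial X C` is by definition the monoid algebra of `X →₀ ℕ`.
  refine ⟨AddMonoidAlgebra.lift C A (X →₀ ℕ) q, fun u hu => ?_⟩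
  refine (AddMonoidAlgebra.lift_single q _ _).trans ?_
  rw [one_smul]
  exact dif_neg hu

/-- Two morphisms with identity out of `Ш_C(X)` are equal if they agree on the image of `𝔅(X)`:
this image contains all monomials except `1`, and
`a₀ ⊗ a₁ ⊗ ⋯ ⊗ aₖ = a₀ ⋄ P_X (a₁ ⊗ ⋯ ⊗ aₖ)`. -/
theorem shaOn_hom_ext {ψ ψ' : ShaOn C X →ₗ[C] A} (hψ : IsBaxterHom (ShaOn.op C X) P ψ)
    (hψ' : IsBaxterHom (ShaOn.op C X) P ψ') (h : ψ ∘ₗ toSha C X = ψ' ∘ₗ toSha C X) : ψ = ψ' := by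
  have hmon : ∀ u : Mon X, ψ (Sha.mk _ (-1 : C) (mon C u) (pureTensor C [])) =
      ψ' (Sha.mk _ (-1 : C) (mon C u) (pureTensor C [])) := by
    intro u
    by_cases hu : u = 1
    · subst hu
      exact hψ.map_one.trans hψ'.map_one.symm
    · have := congrArg (fun f => f (Cartier.of C (Symb.ofMon u hu))) h
      simpa only [LinearMap.comp_apply, toSha_ofMon] using this
  have hpoly : ∀ a, ψ (Sha.mk _ (-1 : C) a (pureTensor C [])) =
      ψ' (Sha.mk _ (-1 : C) a (pureTensor C [])) := by
    intro a
    induction a using MvPolynomial.induction_on' with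
    | monomial u c =>
      have hc : MvPolynomial.monomial u c = c • mon C (Multiplicative.ofAdd u) := by
        rw [mon, MvPolynomial.smul_monomial, smul_eq_mul, mul_one]
        rfl
      rw [hc, Sha.smul_mk, map_smul, map_smul, hmon]
    | add a b ha hb => rw [Sha.add_mk, map_add, map_add, ha, hb]
  refine Sha.hom_ext fun a l => ?_
  induction l generalizing a with
  | nil => exact hpoly a
  | cons b l ih =>
    have hmul : Sha.mk _ (-1 : C) a (pureTensor C (b :: l)) =
        Sha.mk _ (-1 : C) a (pureTensor C []) * ShaOn.op C X (Sha.mk _ _ b (pureTensor C l)) := by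
      rw [Sha.op_mk, Sha.mk_mul_mk, mul_one, mixableShuffleProduct_nil_left]
    rw [hmul, hψ.map_mul, hψ'.map_mul, hψ.map_op, hψ'.map_op, hpoly, ih]

end Universal

end MixableShuffle
end

open MixableShuffle
theorem proposition5p2 {C : Type*} [CommRing C] (X : Type*) :
    -- `𝔅(X)` is an object of `Bax⁰_C` and `Ш_C(X)` is an object of `Bax_C`, both of weight `-1`
    IsNonUnitalBaxterAlgebra (-1 : C) (Cartier.op C X) ∧
    IsBaxterAlgebra (-1 : C) (ShaOn.op C X) ∧
    -- `f` is an injective morphism of `Bax⁰_C`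
    IsNonUnitalBaxterHom (Cartier.op C X) (ShaOn.op C X) (toSha C X) ∧
    Function.Injective (toSha C X) ∧
    -- every morphism `φ` of `Bax⁰_C` into an object `(A, P)` of `Bax_C` factors uniquely through `f`
    -- by a morphism `ψ` of `Bax_C`
    ∀ (A : Type*) [CommRing A] [Algebra C A] (P : A →ₗ[C] A), IsBaxterOperator (-1 : C) P →
      ∀ φ : Cartier C X →ₗ[C] A, IsNonUnitalBaxterHom (Cartier.op C X) P φ →
        ∃! ψ : ShaOn C X →ₗ[C] A,
          IsBaxterHom (ShaOn.op C X) P ψ ∧ ψ ∘ₗ toSha C X = φ := by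
  have hf : IsNonUnitalBaxterHom (Cartier.op C X) (ShaOn.op C X) (toSha C X) :=
    ⟨toSha_mul, toSha_op⟩
  refine ⟨isNonUnitalBaxterAlgebra_cartier C X, isBaxterAlgebra_sha _ _, hf, toSha_injective, ?_⟩
  intro A _ _ P hP φ hφ
  obtain ⟨g, hg⟩ := exists_algHom_mon φ hφ.map_mul
  have hψ := isBaxterHom_extend g hP
  have hcomp : Sha.extend g P (-1 : C) ∘ₗ toSha C X = φ := by
    refine cartier_hom_ext ⟨fun x y => ?_, fun x => ?_⟩ hφ fun u hu => ?_
    · rw [LinearMap.comp_apply, hf.map_mul, hψ.map_mul]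
      rfl
    · rw [LinearMap.comp_apply, hf.map_op, hψ.map_op]
      rfl
    · rw [LinearMap.comp_apply, toSha_ofMon, Sha.extend_mk, Tens.extend_nil, mul_one, hg u hu]
  exact ⟨_, ⟨hψ, hcomp⟩, fun ψ' h => shaOn_hom_ext h.1 hψ (h.2.trans hcomp.symm)⟩
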